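/- Let $\lambda_1,\lambda_2,\lambda_3$ be sequences each of which consists of the normalised Fourier coefficients of a Hecke eigenform for $SL(2,\mathbb Z)$, holomorphic or Maass. That is, each $\lambda_i$ arises in one of two ways. (a) There is a holomorphic cusp form $f$ of some integral weight $k$ for $SL(2,\mathbb Z)$, an eigenfunction of all Hecke operators $T_n$, with $f(z)=\sum_{n\ge1}\lambda_i(n)\,n^{(k-1)/2}e^{2\pi i nz}$ and $\lambda_i(1)=1$. (b) There is a Maass cusp form $f$ of weight $0$ for $SL(2,\mathbb Z)$ with Laplace eigenvalue $\tfrac14+\nu^2$, an eigenfunction of all Hecke operators $T_n$ $(n\ge1)$, with $f(x+iy)=\sqrt y\sum_{n\ne0}\lambda_i(n)K_{i\nu}(2\pi|n|y)e^{2\pi i nx}$ and $\lambda_i(1)=1$. Let $V,W:\mathbb R\to\mathbb R$ be smooth functions supported on $[1,2]$, and for real $N\ge1$ and $H>0$ put $$S(N,H)=\frac1H\sum_{h\ge1}V\!\left(\frac hH\right)\sum_{n\ge1}\lambda_1(n)\lambda_2(n+h)\lambda_3(n+2h)\,W\!\left(\frac nN\right).$$ (i) For every $\varepsilon>0$ there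 is $\delta=\delta(\varepsilon)>0$, depending only on $\varepsilon$, such that for all such $\lambda_i$, $V$, $W$ and every $c>0$ there is a constant $C$ with $|S(N,H)|\le C\,N^{1-\delta}$ for all $N\ge1$ and all $H\ge c\,N^{1/2+\varepsilon}$. (ii) For all such $\lambda_i$, $V$, $W$ and every $\varepsilon>0$ there is a constant $C$ with $$|S(N,H)|\le C\left(\frac{N^{3/2+\varepsilon}}{H}+N^{1/2+\varepsilon}\right)\qquad\text{for all } N\ge1,\ H>0;$$ in particular $|S(N,H)|\le 2C\,N^{3/2+\varepsilon}/H$ if $H\le N$. -/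

import Mathlib

open scoped MatrixGroups ContDiff

noncomputable section

namespace DoubleShift

open UpperHalfPlane

/-- `∑_{b mod d} f((a z + b) / d)`. For `a, d ≥ 1` and `z` in the upper half plane every point
`(a z + b) / d` lies in the upper half plane, where `ofComplex` is the identity. -/
def heckeTranslates (f : ℍ → ℂ) (a d : ℕ) (z : ℍ) : ℂ :=
  ∑ b ∈ Finset.range d, f (ofComplex (((a : ℂ) * (z : ℂ) + (b : ℂ)) / (d : ℂ)))

/-- The `n`-th Hecke operator of level one in weight `k`:
`(T_n f)(z) = n ^ (k - 1) * ∑_{a d = n} d ^ (-k) ∑_{b mod d} f((a z + b) / d)`. -/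
def heckeHol (k : ℤ) (n : ℕ) (f : ℍ → ℂ) (z : ℍ) : ℂ :=
  (n : ℂ) ^ (k - 1) *
    ∑ p ∈ n.divisorsAntidiagonal, (p.2 : ℂ) ^ (-k) * heckeTranslates f p.1 p.2 z

/-- The `n`-th Hecke operator of level one on functions of weight zero, normalised as for Maass
forms: `(T_n f)(z) = n ^ (-1/2) * ∑_{a d = n} ∑_{b mod d} f((a z + b) / d)`. -/
def heckeMaass (n : ℕ) (f : ℍ → ℂ) (z : ℍ) : ℂ :=
  ((Real.sqrt (n : ℝ) : ℝ) : ℂ)⁻¹ *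
    ∑ p ∈ n.divisorsAntidiagonal, heckeTranslates f p.1 p.2 z

/-- The K-Bessel function `K_s(y) = ∫_0^∞ exp (-y cosh t) cosh (s t) dt`, for `y > 0`. -/
def besselK (s : ℂ) (y : ℝ) : ℂ :=
  ∫ t in Set.Ioi (0 : ℝ), ((Real.exp (-(y * Real.cosh t)) : ℝ) : ℂ) * Complex.cosh (s * (t : ℂ))

/-- `lam` is the sequence of normalised Fourier coefficients of a holomorphic Hecke cusp form `f`
for `SL(2, ℤ)`: `f(z) = ∑_{n ≥ 1} lam(n) n ^ ((k - 1) / 2) e(n z)` with `lam(1) = 1`. -/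
def IsHolomorphicHeckeCoeff (lam : ℕ → ℂ) : Prop :=
  ∃ (k : ℤ) (f : CuspForm 𝒮ℒ k),
    (∀ n : ℕ, 1 ≤ n → ∃ μ : ℂ, ∀ z : ℍ, heckeHol k n f z = μ * f z) ∧
    (∀ n : ℕ, 1 ≤ n →
      (qExpansion 1 f).coeff n = lam n * (((n : ℝ) ^ (((k : ℝ) - 1) / 2) : ℝ) : ℂ)) ∧
    lam 1 = 1

/-- `f` is a Maass cusp form (weight zero) for `SL(2, ℤ)` with Laplace eigenvalue `1/4 + ν ^ 2`.
Here `Δ` is the Euclidean Laplacian `∂²/∂x² + ∂²/∂y²`, so that `-y ^ 2 Δ` is the hyperbolic one. -/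
structure IsMaassCuspForm (ν : ℂ) (f : ℍ → ℂ) : Prop where
  smooth : ContDiffOn ℝ ∞ (fun w : ℂ => f (ofComplex w)) {w : ℂ | 0 < w.im}
  invariant : ∀ (γ : SL(2, ℤ)) (z : ℍ), f (γ • z) = f z
  eigen : ∀ z : ℍ,
    -((z.im : ℂ) ^ 2) * Laplacian.laplacian (fun w : ℂ => f (ofComplex w)) (z : ℂ) =
      (1 / 4 + ν ^ 2) * f z
  moderate : ∃ A B : ℝ, ∀ z : ℍ, 1 ≤ z.im → ‖f z‖ ≤ B * z.im ^ A
  cuspidal : ∀ y : ℝ, 0 < y →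
    ∫ x in (0 : ℝ)..1, f (ofComplex ((x : ℂ) + (y : ℂ) * Complex.I)) = 0

/-- `lam` is the sequence of normalised Fourier coefficients (at the positive integers) of a Maass
cusp form `f` for `SL(2, ℤ)` that is an eigenfunction of all Hecke operators:
`f(x + i y) = √y ∑_{n ≠ 0} c(n) K_{iν}(2 π |n| y) e(n x)` with `c(1) = 1` and `lam(n) = c(n)`. -/
def IsMaassHeckeCoeff (lam : ℕ → ℂ) : Prop :=
  ∃ (ν : ℂ) (f : ℍ → ℂ) (c : ℤ → ℂ),
    IsMaassCuspForm ν f ∧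
    (∀ n : ℕ, 1 ≤ n → ∃ μ : ℂ, ∀ z : ℍ, heckeMaass n f z = μ * f z) ∧
    (∀ z : ℍ, HasSum
      (fun n : {n : ℤ // n ≠ 0} =>
        ((Real.sqrt z.im : ℝ) : ℂ) * c n *
          besselK (Complex.I * ν) (2 * Real.pi * |((n : ℤ) : ℝ)| * z.im) *
          Complex.exp (2 * Real.pi * Complex.I * ((n : ℤ) : ℂ) * (z.re : ℂ)))
      (f z)) ∧
    c 1 = 1 ∧
    (∀ n : ℕ, 1 ≤ n → lam n = c n)

/-- Normalised Fourier coefficients of a Hecke eigenform for `SL(2, ℤ)`, holomorphic or Maass. -/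
def IsHeckeCoeff (lam : ℕ → ℂ) : Prop :=
  IsHolomorphicHeckeCoeff lam ∨ IsMaassHeckeCoeff lam

/-- A smooth function on the real line supported on `[1, 2]`. -/
def IsBump (V : ℝ → ℝ) : Prop :=
  ContDiff ℝ ∞ V ∧ tsupport V ⊆ Set.Icc 1 2

/-- `H⁻¹ ∑_h V(h / H) ∑_n l₁(n) l₂(n + h) l₃(n + 2 h) W(n / N)` over all positive integers
`h, n`; for `V`, `W` supported on `[1, 2]` only `h ≤ 2 H` and `n ≤ 2 N` contribute. -/
def doubleShiftSum (l₁ l₂ l₃ : ℕ → ℂ) (V W : ℝ → ℝ) (N H : ℝ) : ℂ :=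
  (1 / (H : ℂ)) * ∑ h ∈ Finset.Icc 1 ⌊2 * H⌋₊, (V ((h : ℝ) / H) : ℂ) *
    ∑ n ∈ Finset.Icc 1 ⌊2 * N⌋₊,
      l₁ n * l₂ (n + h) * l₃ (n + 2 * h) * (W ((n : ℝ) / N) : ℂ)

end DoubleShift

end

open MeasureTheory

noncomputable section

namespace DoubleShift

open UpperHalfPlane

/-! A progression n, n + h, n + 2h is determined by its last two terms: if b = n + h and c = n + 2h,
then n = 2b - c and h = c - b. Detecting both relations by integrals over [0, 1] leaves four
exponential sums. The sum over n, carrying λ₁ and W, is taken in sup norm; those over b and c,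
carrying λ₂ and λ₃, in ℓ² by Cauchy-Schwarz and Parseval; that over h, carrying V, in L¹. These
contribute O(√N), O(√(N + H)) twice, and O(1). After division by H the total is √N (N + H) / H,
which is `exists_norm_doubleShiftSum_le`; both assertions follow by comparing exponents.

The automorphic input is the boundedness of a form along horocycles, isolated in `HasBoundedModel`:
the coefficients, weighted by a function Φ(ny), are Fourier coefficients of a function bounded
uniformly in the height y. Bessel's inequality then bounds their mean square, and pairing with a
kernel of bounded L¹ norm (`integral_norm_kernel_le`) gives Wilton's bound `norm_twisted_sum_le`,
where Φ is divided out of the weight.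

For a holomorphic form the bounded function is y^(k/2) f. For a Maass form it is f itself:
exponential decay of the K-Bessel function bounds f at the cusp and invariance does the rest. The
lower bound `exists_le_norm_besselK` serves both to control the growth of the coefficients and to
allow division by Φ. -/

/-! ### Additive characters and finite trigonometric sums -/

/-- The additive character `x ↦ exp (2 π i x)`. -/
def e (x : ℝ) : ℂ := Complex.exp (2 * Real.pi * Complex.I * x)

lemma e_add (x y : ℝ) : e (x + y) = e x * e y := by
  rw [e, e, e, ← Complex.exp_add]; push_cast; ring_nf

lemma e_zero : e 0 = 1 := by simp [e]

lemma e_int (n : ℤ) : e n = 1 := by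
  rw [e, Complex.exp_eq_one_iff]
  exact ⟨n, by push_cast; ring⟩

lemma norm_e (x : ℝ) : ‖e x‖ = 1 := by
  rw [e, show 2 * Real.pi * Complex.I * (x : ℂ) = ((2 * Real.pi * x : ℝ) : ℂ) * Complex.I by
    push_cast; ring]
  exact Complex.norm_exp_ofReal_mul_I _

lemma conj_e (x : ℝ) : (starRingEnd ℂ) (e x) = e (-x) := by
  rw [e, e, ← Complex.exp_conj]
  simp [Complex.conj_ofNat]

@[fun_prop]
lemma continuous_e : Continuous e := by
  unfold e; fun_prop

lemma integral_e_int (n : ℤ) : ∫ x in (0 : ℝ)..1, e (n * x) = if n = 0 then 1 else 0 := by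
  split_ifs with h
  · simp [h, e_zero]
  · have h0 : (2 * Real.pi * Complex.I * n : ℂ) ≠ 0 := by
      simp [Real.pi_ne_zero, h]
    have := integral_exp_mul_complex (a := 0) (b := 1) h0
    have h1 := e_int n
    rw [e] at h1
    simp only [e]
    push_cast at h1 ⊢
    simp only [← mul_assoc]
    rw [this]
    simp [h1]

/-- Parseval's identity for finite trigonometric sums. -/
lemma integral_norm_sq_trigSum {ι : Type*} (s : Finset ι) (a : ι → ℂ) (k : ι → ℤ)
    (hk : Set.InjOn k s) :
    ∫ x in (0 : ℝ)..1, ‖∑ i ∈ s, a i * e (k i * x)‖ ^ 2 = ∑ i ∈ s, ‖a i‖ ^ 2 := by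
  classical
  have h1 : ∀ x : ℝ, ((‖∑ i ∈ s, a i * e (k i * x)‖ ^ 2 : ℝ) : ℂ) =
      ∑ i ∈ s, ∑ j ∈ s, a i * (starRingEnd ℂ) (a j) * e ((k i - k j : ℤ) * x) := by
    intro x
    rw [← Complex.normSq_eq_norm_sq, ← Complex.mul_conj, map_sum, Finset.sum_mul_sum]
    refine Finset.sum_congr rfl fun i _ => Finset.sum_congr rfl fun j _ => ?_
    rw [map_mul, conj_e, show (((k i - k j : ℤ) : ℝ) * x) = k i * x + -(k j * x) by
      push_cast; ring, e_add]
    ring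
  have h2 : ((∫ x in (0 : ℝ)..1, ‖∑ i ∈ s, a i * e (k i * x)‖ ^ 2 : ℝ) : ℂ) =
      ((∑ i ∈ s, ‖a i‖ ^ 2 : ℝ) : ℂ) := by
    rw [← intervalIntegral.integral_ofReal]
    simp_rw [h1]
    rw [intervalIntegral.integral_finsetSum
      (fun i _ => Continuous.intervalIntegrable (by fun_prop) _ _)]
    rw [Complex.ofReal_sum]
    refine Finset.sum_congr rfl fun i hi => ?_
    rw [intervalIntegral.integral_finsetSum
      (fun i _ => Continuous.intervalIntegrable (by fun_prop) _ _)]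
    simp_rw [intervalIntegral.integral_const_mul, integral_e_int]
    rw [Finset.sum_eq_single_of_mem i hi]
    · simp [Complex.mul_conj, Complex.normSq_eq_norm_sq]
    · intro j hj hji
      have h : k i - k j ≠ 0 := fun h => hji (hk hj hi (by omega))
      rw [if_neg h, mul_zero]
  exact_mod_cast h2

/-- The Fourier coefficients of a finite trigonometric sum. -/
lemma integral_trigSum_mul_e (s : Finset ℕ) (a : ℕ → ℂ) (m : ℤ) :
    ∫ x in (0 : ℝ)..1, (∑ i ∈ s, a i * e (i * x)) * e (-(m * x)) =
      ∑ i ∈ s, if (i : ℤ) = m then a i else 0 := by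
  have h1 : ∀ x : ℝ, (∑ i ∈ s, a i * e (i * x)) * e (-(m * x)) =
      ∑ i ∈ s, a i * e (((i : ℤ) - m : ℤ) * x) := by
    intro x
    rw [Finset.sum_mul]
    refine Finset.sum_congr rfl fun i _ => ?_
    rw [mul_assoc, ← e_add]
    congr 2
    push_cast; ring
  simp_rw [h1]
  rw [intervalIntegral.integral_finsetSum
    (fun i _ => Continuous.intervalIntegrable (by fun_prop) _ _)]
  refine Finset.sum_congr rfl fun i _ => ?_
  rw [intervalIntegral.integral_const_mul, integral_e_int]
  by_cases h : (i : ℤ) = m <;> simp [h, sub_eq_zero]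

/-! ### The L¹ norm of smoothly weighted exponential sums -/

lemma norm_one_sub_e (x : ℝ) : ‖1 - e x‖ = 2 * |Real.sin (Real.pi * x)| := by
  have h : ‖1 - e x‖ ^ 2 = (2 * |Real.sin (Real.pi * x)|) ^ 2 := by
    rw [← Complex.normSq_eq_norm_sq, mul_pow, sq_abs, Complex.normSq_apply, e,
      show 2 * Real.pi * Complex.I * (x : ℂ) = ((2 * (Real.pi * x) : ℝ) : ℂ) * Complex.I by
        push_cast; ring]
    simp only [Complex.sub_re, Complex.sub_im, Complex.one_re, Complex.one_im,
      Complex.exp_ofReal_mul_I_re, Complex.exp_ofReal_mul_I_im]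
    rw [Real.cos_two_mul, Real.sin_two_mul]
    have := Real.sin_sq_add_cos_sq (Real.pi * x)
    nlinarith
  exact (sq_eq_sq₀ (norm_nonneg _) (by positivity)).mp h

/-- Jordan's inequality for the sine, applied on either side of x = 1/2. -/
lemma four_mul_min_le_norm_one_sub_e {x : ℝ} (h0 : 0 ≤ x) (h1 : x ≤ 1) :
    4 * min x (1 - x) ≤ ‖1 - e x‖ := by
  have key : ∀ t : ℝ, 0 ≤ t → t ≤ 1 / 2 → 2 * t ≤ Real.sin (Real.pi * t) := by
    intro t h0 h1
    have := Real.mul_le_sin (x := Real.pi * t) (by positivity) (by nlinarith [Real.pi_pos])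
    have h2 : 2 / Real.pi * (Real.pi * t) = 2 * t := by
      field_simp
    linarith
  rw [norm_one_sub_e]
  have habs := le_abs_self (Real.sin (Real.pi * x))
  rcases le_total x (1 / 2) with h | h
  · have := key x h0 h
    have := min_le_left x (1 - x)
    linarith
  · have h2 := key (1 - x) (by linarith) (by linarith)
    rw [show Real.pi * (1 - x) = Real.pi - Real.pi * x by ring, Real.sin_pi_sub] at h2
    have := min_le_right x (1 - x)
    linarith

lemma integral_inv_one_add_mul_sq_le {N : ℝ} (hN : 0 < N) :
    ∫ x in (0 : ℝ)..1, (1 + (4 * N * x) ^ 2)⁻¹ ≤ 1 / N := by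
  have h := intervalIntegral.integral_comp_mul_left (a := 0) (b := 1)
    (fun x : ℝ => (1 + x ^ 2)⁻¹) (c := 4 * N) (by positivity)
  rw [h]
  simp only [mul_zero, mul_one, integral_inv_one_add_sq, Real.arctan_zero, sub_zero, smul_eq_mul]
  have h1 := (Real.arctan_lt_pi_div_two (4 * N)).le
  have h2 := Real.pi_le_four
  calc (4 * N)⁻¹ * Real.arctan (4 * N) ≤ (4 * N)⁻¹ * 4 := by gcongr; linarith
    _ = 1 / N := by field_simp

/-- The integrand is concentrated within 1/N of the integers. It is the dual weight in the L¹
estimate below, where it is multiplied by N / 2. -/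
lemma integral_inv_one_add_norm_sq_le {N : ℝ} (hN : 0 < N) :
    ∫ x in (0 : ℝ)..1, (1 + N ^ 2 * ‖1 - e x‖ ^ 2)⁻¹ ≤ 2 / N := by
  have hc : Continuous fun x : ℝ => (1 + (4 * N * x) ^ 2)⁻¹ :=
    Continuous.inv₀ (by fun_prop) fun x => by positivity
  have hc' : Continuous fun x : ℝ => (1 + (4 * N * (1 - x)) ^ 2)⁻¹ :=
    Continuous.inv₀ (by fun_prop) fun x => by positivity
  have hle : ∫ x in (0 : ℝ)..1, (1 + N ^ 2 * ‖1 - e x‖ ^ 2)⁻¹ ≤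
      ∫ x in (0 : ℝ)..1, ((1 + (4 * N * x) ^ 2)⁻¹ + (1 + (4 * N * (1 - x)) ^ 2)⁻¹) := by
    refine intervalIntegral.integral_mono_on zero_le_one ?_ ?_ ?_
    · exact (Continuous.inv₀ (by fun_prop) fun x => by positivity).intervalIntegrable _ _
    · exact (hc.add hc').intervalIntegrable _ _
    · intro x hx
      have h := four_mul_min_le_norm_one_sub_e hx.1 hx.2
      rcases le_total x (1 - x) with hx' | hx'
      · rw [min_eq_left hx'] at h
        have h2 : (4 * N * x) ^ 2 ≤ N ^ 2 * ‖1 - e x‖ ^ 2 := by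
          rw [← mul_pow]
          exact pow_le_pow_left₀ (by have := hx.1; positivity) (by nlinarith) 2
        have h3 : (1 + N ^ 2 * ‖1 - e x‖ ^ 2)⁻¹ ≤ (1 + (4 * N * x) ^ 2)⁻¹ := by gcongr
        have h4 : 0 ≤ (1 + (4 * N * (1 - x)) ^ 2)⁻¹ := by positivity
        linarith
      · rw [min_eq_right hx'] at h
        have h2 : (4 * N * (1 - x)) ^ 2 ≤ N ^ 2 * ‖1 - e x‖ ^ 2 := by
          rw [← mul_pow]
          have := hx.2
          exact pow_le_pow_left₀ (mul_nonneg (by positivity) (by linarith)) (by nlinarith) 2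
        have h3 : (1 + N ^ 2 * ‖1 - e x‖ ^ 2)⁻¹ ≤ (1 + (4 * N * (1 - x)) ^ 2)⁻¹ := by gcongr
        have h4 : 0 ≤ (1 + (4 * N * x) ^ 2)⁻¹ := by positivity
        linarith
  rw [intervalIntegral.integral_add (hc.intervalIntegrable _ _) (hc'.intervalIntegrable _ _)] at hle
  have hs := intervalIntegral.integral_comp_sub_left (a := 0) (b := 1)
    (fun x : ℝ => (1 + (4 * N * x) ^ 2)⁻¹) 1
  simp only [sub_self, sub_zero] at hs
  rw [hs] at hle
  have := integral_inv_one_add_mul_sq_le hN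
  have h2 : 2 / N = 1 / N + 1 / N := by ring
  linarith

/-- Summation by parts: multiplying a trigonometric sum by `1 - e x` differences its
coefficients. -/
lemma one_sub_e_mul_trigSum (g : ℕ → ℂ) (M : ℕ) (h0 : g 0 = 0) (hM : g (M + 1) = 0) (x : ℝ) :
    (1 - e x) * ∑ n ∈ Finset.Icc 1 M, g n * e (n * x) =
      ∑ n ∈ Finset.range (M + 1), (g (n + 1) - g n) * e (((n : ℤ) + 1 : ℤ) * x) := by
  have h1 : ∑ n ∈ Finset.Icc 1 M, g n * e (n * x) =
      ∑ n ∈ Finset.range (M + 1), g n * e (n * x) := by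
    rw [Finset.range_eq_Ico, Finset.sum_eq_sum_Ico_succ_bot (by omega), h0, zero_mul, zero_add]
    rfl
  have h2 : ∑ n ∈ Finset.range (M + 1), g n * e (n * x) =
      ∑ n ∈ Finset.range (M + 1), g (n + 1) * e (((n + 1 : ℕ) : ℝ) * x) := by
    have ha := Finset.sum_range_succ' (fun n : ℕ => g n * e (n * x)) (M + 1)
    have hb := Finset.sum_range_succ (fun n : ℕ => g n * e (n * x)) (M + 1)
    simp only [hM, h0, zero_mul, add_zero] at ha hb
    rw [← hb, ha]
  rw [sub_mul, one_mul, h1]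
  conv_lhs => rw [h2]
  rw [← h2, Finset.mul_sum, h2, ← Finset.sum_sub_distrib]
  refine Finset.sum_congr rfl fun n _ => ?_
  have : e (((n : ℤ) + 1 : ℤ) * x) = e x * e (n * x) := by
    rw [← e_add]; congr 1; push_cast; ring
  rw [this, show ((n + 1 : ℕ) : ℝ) * x = x + n * x by push_cast; ring, e_add]
  ring

/-- The exponential sum attached to a Lipschitz weight supported on `[1, 2]` has bounded
`L¹` norm. -/
lemma integral_norm_kernel_le {G : ℝ → ℂ} {L : ℝ} (hsupp : ∀ u ∉ Set.Icc (1 : ℝ) 2, G u = 0)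
    (hL : ∀ u v, ‖G u - G v‖ ≤ L * |u - v|) {N : ℝ} (hN : 1 / 2 ≤ N) :
    ∫ x in (0 : ℝ)..1, ‖∑ n ∈ Finset.Icc 1 ⌊2 * N⌋₊, G (n / N) * e (n * x)‖ ≤ 6 * L ^ 2 + 1 := by
  have hN0 : 0 < N := by linarith
  set M := ⌊2 * N⌋₊ with hM
  set T : ℝ → ℂ := fun x => ∑ n ∈ Finset.Icc 1 M, G (n / N) * e (n * x) with hT
  have hMle : (M : ℝ) ≤ 2 * N := Nat.floor_le (by positivity)
  have hG0 : G 0 = 0 := hsupp 0 (by simp)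
  -- Comparison with G 0 = 0 turns the Lipschitz constant into a sup bound 2L on [1, 2].
  have hGb : ∀ u, ‖G u‖ ^ 2 ≤ 4 * L ^ 2 := by
    intro u
    by_cases hu : u ∈ Set.Icc (1 : ℝ) 2
    · have h := hL u 0
      rw [hG0, sub_zero, sub_zero, abs_of_nonneg (by linarith [hu.1])] at h
      have hL0 : 0 ≤ L := by
        by_contra hneg
        push Not at hneg
        have := norm_nonneg (G u)
        nlinarith [hu.1]
      calc ‖G u‖ ^ 2 ≤ (L * 2) ^ 2 := by
            gcongr
            exact h.trans (by gcongr; exact hu.2)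
        _ = 4 * L ^ 2 := by ring
    · rw [hsupp u hu]; simp; positivity
  have hTc : Continuous T := by fun_prop
  have hD : ∀ x, (1 - e x) * T x = ∑ n ∈ Finset.range (M + 1),
      (G ((n + 1 : ℕ) / N) - G (n / N)) * e (((n : ℤ) + 1 : ℤ) * x) := by
    intro x
    refine one_sub_e_mul_trigSum (fun n => G (n / N)) M (by simpa using hG0) ?_ x
    refine hsupp _ fun h => ?_
    have h1 := h.2
    rw [div_le_iff₀ hN0] at h1
    have h2 := Nat.lt_floor_add_one (2 * N)
    rw [← hM] at h2
    push_cast at h1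
    linarith
  have hP : ∫ x in (0 : ℝ)..1, ‖T x‖ ^ 2 ≤ 8 * N * L ^ 2 := by
    have := integral_norm_sq_trigSum (Finset.Icc 1 M) (fun n => G (n / N)) (fun n => (n : ℤ))
      (fun a _ b _ h => by simpa using h)
    simp only [Int.cast_natCast] at this
    rw [hT, this]
    calc ∑ n ∈ Finset.Icc 1 M, ‖G (n / N)‖ ^ 2 ≤ ∑ n ∈ Finset.Icc 1 M, 4 * L ^ 2 :=
          Finset.sum_le_sum fun n _ => hGb _
      _ = M * (4 * L ^ 2) := by simp
      _ ≤ 2 * N * (4 * L ^ 2) := by gcongr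
      _ = 8 * N * L ^ 2 := by ring
  have hQ : ∫ x in (0 : ℝ)..1, ‖(1 - e x) * T x‖ ^ 2 ≤ 4 * L ^ 2 / N := by
    simp_rw [hD]
    rw [integral_norm_sq_trigSum (Finset.range (M + 1))
      (fun n => G ((n + 1 : ℕ) / N) - G (n / N)) (fun n => (n : ℤ) + 1)
      (fun a _ b _ h => by simpa using h)]
    calc ∑ n ∈ Finset.range (M + 1), ‖G ((n + 1 : ℕ) / N) - G (n / N)‖ ^ 2
        ≤ ∑ n ∈ Finset.range (M + 1), L ^ 2 / N ^ 2 := by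
          refine Finset.sum_le_sum fun n _ => ?_
          have h := hL ((n + 1 : ℕ) / N) (n / N)
          rw [show ((n + 1 : ℕ) : ℝ) / N - n / N = 1 / N by push_cast; ring,
            abs_of_pos (by positivity)] at h
          calc _ ≤ (L * (1 / N)) ^ 2 := by gcongr
            _ = L ^ 2 / N ^ 2 := by ring
      _ = (M + 1) * (L ^ 2 / N ^ 2) := by simp
      -- M + 1 ≤ 2N + 1 ≤ 4N; this is where N ≥ 1/2 enters.
      _ ≤ (4 * N) * (L ^ 2 / N ^ 2) := by gcongr; linarith
      _ = 4 * L ^ 2 / N := by field_simp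
  -- Pointwise form of a weighted Cauchy-Schwarz: by AM-GM, |T| ≤ w|T|²/(2N) + N/(2w) with w = 1 +
  -- N²|1 - e(x)|². All three terms then integrate to O(1).
  have hpt : ∀ x, ‖T x‖ ≤ (1 / (2 * N)) * ‖T x‖ ^ 2 + (N / 2) * ‖(1 - e x) * T x‖ ^ 2 +
      (N / 2) * (1 + N ^ 2 * ‖1 - e x‖ ^ 2)⁻¹ := by
    intro x
    set w := 1 + N ^ 2 * ‖1 - e x‖ ^ 2 with hw
    have hw0 : 0 < w := by positivity
    have h1 : (1 / (2 * N)) * ‖T x‖ ^ 2 + (N / 2) * ‖(1 - e x) * T x‖ ^ 2 =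
        w * ‖T x‖ ^ 2 / (2 * N) := by
      rw [norm_mul, hw]; field_simp
    rw [h1]
    have h2 : w * ‖T x‖ ^ 2 / (2 * N) + N / 2 * w⁻¹ - ‖T x‖ =
        (w * ‖T x‖ - N) ^ 2 / (2 * N * w) := by
      field_simp; ring
    have h3 : 0 ≤ (w * ‖T x‖ - N) ^ 2 / (2 * N * w) := by positivity
    linarith
  have hc1 : Continuous fun x => (1 / (2 * N)) * ‖T x‖ ^ 2 := by fun_prop
  have hc2 : Continuous fun x => (N / 2) * ‖(1 - e x) * T x‖ ^ 2 := by fun_prop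
  have hc3 : Continuous fun x => (N / 2) * (1 + N ^ 2 * ‖1 - e x‖ ^ 2)⁻¹ :=
    continuous_const.mul (Continuous.inv₀ (by fun_prop) fun x => by positivity)
  have hc12 : Continuous fun x => (1 / (2 * N)) * ‖T x‖ ^ 2 + (N / 2) * ‖(1 - e x) * T x‖ ^ 2 :=
    hc1.add hc2
  have hmono := intervalIntegral.integral_mono_on (zero_le_one (α := ℝ))
    (hTc.norm.intervalIntegrable (μ := volume) _ _)
    ((hc12.add hc3).intervalIntegrable (μ := volume) _ _) (fun x _ => hpt x)
  refine hmono.trans ?_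
  simp only [Pi.add_apply]
  rw [intervalIntegral.integral_add (hc12.intervalIntegrable _ _)
    (hc3.intervalIntegrable _ _), intervalIntegral.integral_add (hc1.intervalIntegrable _ _)
    (hc2.intervalIntegrable _ _), intervalIntegral.integral_const_mul,
    intervalIntegral.integral_const_mul, intervalIntegral.integral_const_mul]
  have hR := integral_inv_one_add_norm_sq_le hN0
  calc _ ≤ (1 / (2 * N)) * (8 * N * L ^ 2) + (N / 2) * (4 * L ^ 2 / N) + (N / 2) * (2 / N) := by
        gcongr
    _ = 6 * L ^ 2 + 1 := by field_simp; ring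

/-! ### Bounded models: mean square of the coefficients and additive twists -/

/-- At every height `y > 0` the numbers `√y l(n) Φ(n y)`, `n ≥ 1`, are Fourier coefficients of a
continuous function bounded independently of `y`, where `Φ` is Lipschitz and bounded away from
zero on `[A, 2A]`. -/
def HasBoundedModel (l : ℕ → ℂ) : Prop :=
  ∃ (Φ : ℝ → ℂ) (A B L m : ℝ), 0 < A ∧ 0 ≤ L ∧ 0 < m ∧
    (∀ u ∈ Set.Icc A (2 * A), m ≤ ‖Φ u‖) ∧
    (∀ u ∈ Set.Icc A (2 * A), ∀ v ∈ Set.Icc A (2 * A), ‖Φ u - Φ v‖ ≤ L * |u - v|) ∧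
    ∀ y : ℝ, 0 < y → ∃ F : ℝ → ℂ, Continuous F ∧ (∀ x, ‖F x‖ ≤ B) ∧
      ∀ n : ℕ, 1 ≤ n →
        ∫ x in (0 : ℝ)..1, F x * e (-(n * x)) = (Real.sqrt y : ℂ) * l n * Φ (n * y)

lemma integral_mul_trigSum {F : ℝ → ℂ} (hF : Continuous F) (s : Finset ℕ) (a : ℕ → ℂ) :
    ∫ x in (0 : ℝ)..1, F x * ∑ n ∈ s, a n * e (-(n * x)) =
      ∑ n ∈ s, a n * ∫ x in (0 : ℝ)..1, F x * e (-(n * x)) := by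
  simp_rw [Finset.mul_sum]
  rw [intervalIntegral.integral_finsetSum
    (fun i _ => Continuous.intervalIntegrable (by fun_prop) _ _)]
  refine Finset.sum_congr rfl fun n _ => ?_
  rw [← intervalIntegral.integral_const_mul]
  congr 1
  ext x
  ring

lemma norm_integral_mul_le {F T : ℝ → ℂ} {B : ℝ} (hF : Continuous F) (hT : Continuous T)
    (hB : ∀ x, ‖F x‖ ≤ B) :
    ‖∫ x in (0 : ℝ)..1, F x * T x‖ ≤ B * ∫ x in (0 : ℝ)..1, ‖T x‖ := by
  refine (intervalIntegral.norm_integral_le_integral_norm zero_le_one).trans ?_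
  rw [← intervalIntegral.integral_const_mul]
  refine intervalIntegral.integral_mono_on zero_le_one
    ((hF.mul hT).norm.intervalIntegrable _ _)
    ((continuous_const.mul hT.norm).intervalIntegrable _ _) fun x _ => ?_
  rw [norm_mul]
  gcongr
  exact hB x

/-- The Cauchy-Schwarz inequality on `[0, 1]`. -/
lemma integral_norm_mul_le_sqrt {P Q : ℝ → ℂ} (hP : Continuous P) (hQ : Continuous Q) :
    ∫ x in (0 : ℝ)..1, ‖P x‖ * ‖Q x‖ ≤
      Real.sqrt (∫ x in (0 : ℝ)..1, ‖P x‖ ^ 2) * Real.sqrt (∫ x in (0 : ℝ)..1, ‖Q x‖ ^ 2) := by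
  set a := ∫ x in (0 : ℝ)..1, ‖P x‖ ^ 2
  set b := ∫ x in (0 : ℝ)..1, ‖P x‖ * ‖Q x‖ with hb
  set c := ∫ x in (0 : ℝ)..1, ‖Q x‖ ^ 2
  have hc0 : 0 ≤ c := intervalIntegral.integral_nonneg zero_le_one fun x _ => by positivity
  have ha0 : 0 ≤ a := intervalIntegral.integral_nonneg zero_le_one fun x _ => by positivity
  -- The quadratic in t is the integral of (|P| + t|Q|)², so its discriminant is nonpositive.
  have hquad : ∀ t : ℝ, 0 ≤ c * (t * t) + (2 * b) * t + a := by
    intro t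
    have h : ∫ x in (0 : ℝ)..1, (‖P x‖ + t * ‖Q x‖) ^ 2 = c * (t * t) + (2 * b) * t + a := by
      have h1 : ∀ x, (‖P x‖ + t * ‖Q x‖) ^ 2 =
          (t * t) * ‖Q x‖ ^ 2 + (2 * t) * (‖P x‖ * ‖Q x‖) + ‖P x‖ ^ 2 := fun x => by ring
      simp_rw [h1]
      rw [intervalIntegral.integral_add (Continuous.intervalIntegrable (by fun_prop) _ _)
        (Continuous.intervalIntegrable (by fun_prop) _ _),
        intervalIntegral.integral_add (Continuous.intervalIntegrable (by fun_prop) _ _)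
        (Continuous.intervalIntegrable (by fun_prop) _ _),
        intervalIntegral.integral_const_mul, intervalIntegral.integral_const_mul]
      ring
    rw [← h]
    exact intervalIntegral.integral_nonneg zero_le_one fun x _ => by positivity
  have hd := discrim_le_zero hquad
  rw [discrim] at hd
  rw [← Real.sqrt_mul ha0]
  exact Real.le_sqrt_of_sq_le (by nlinarith)

lemma integral_norm_le_sqrt {P : ℝ → ℂ} (hP : Continuous P) :
    ∫ x in (0 : ℝ)..1, ‖P x‖ ≤ Real.sqrt (∫ x in (0 : ℝ)..1, ‖P x‖ ^ 2) := by
  simpa using integral_norm_mul_le_sqrt hP (continuous_const (y := (1 : ℂ)))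

/-- Bessel's inequality for bounded functions. -/
lemma sum_norm_sq_fourierCoeff_le {F : ℝ → ℂ} {B : ℝ} (hF : Continuous F) (hB : ∀ x, ‖F x‖ ≤ B)
    (s : Finset ℕ) :
    ∑ n ∈ s, ‖∫ x in (0 : ℝ)..1, F x * e (-(n * x))‖ ^ 2 ≤ B ^ 2 := by
  set b : ℕ → ℂ := fun n => ∫ x in (0 : ℝ)..1, F x * e (-(n * x)) with hb
  set Z := ∑ n ∈ s, ‖b n‖ ^ 2 with hZ
  have hZ0 : 0 ≤ Z := Finset.sum_nonneg fun n _ => by positivity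
  have hB0 : 0 ≤ B := (norm_nonneg _).trans (hB 0)
  -- Duality: testing F against the polynomial built from its own conjugated coefficients gives Z ≤
  -- B √Z.
  have h1 := integral_mul_trigSum hF s (fun n => (starRingEnd ℂ) (b n))
  have h2 : ∑ n ∈ s, (starRingEnd ℂ) (b n) * ∫ x in (0 : ℝ)..1, F x * e (-(n * x)) = (Z : ℂ) := by
    rw [hZ, Complex.ofReal_sum]
    refine Finset.sum_congr rfl fun n _ => ?_
    change (starRingEnd ℂ) (b n) * b n = _
    rw [mul_comm, Complex.mul_conj, Complex.normSq_eq_norm_sq]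
  have hT : Continuous fun x : ℝ => ∑ n ∈ s, (starRingEnd ℂ) (b n) * e (-(n * x)) := by fun_prop
  have h3 := norm_integral_mul_le hF hT hB
  have h4 := integral_norm_sq_trigSum s (fun n => (starRingEnd ℂ) (b n)) (fun n => -(n : ℤ))
    (fun a _ b _ h => by simpa using h)
  simp only [Int.cast_neg, Int.cast_natCast, neg_mul, RCLike.norm_conj] at h4
  have h5 := integral_norm_le_sqrt hT
  rw [h4, ← hZ] at h5
  rw [h1, h2, Complex.norm_real, Real.norm_of_nonneg hZ0] at h3
  have h6 : Z ≤ B * Real.sqrt Z := h3.trans (by gcongr)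
  have h7 := Real.sq_sqrt hZ0
  have h8 := Real.sqrt_nonneg Z
  rcases h8.eq_or_lt with h | h
  · rw [← h7, ← h]; nlinarith
  · have h9 : Real.sqrt Z ≤ B := by
      by_contra hcon
      push Not at hcon
      nlinarith
    rw [← h7]
    gcongr

/-- Halving induction: the initial segment up to ⌊M/2⌋ costs at most C M/2, which is exactly what
the top block leaves over. -/
lemma sum_norm_sq_le_of_dyadic {a : ℕ → ℝ} {C : ℝ}
    (h : ∀ M : ℕ, 1 ≤ M → ∑ n ∈ Finset.Ioc (M / 2) M, a n ≤ C * (M / 2)) (hC : 0 ≤ C) (M : ℕ) :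
    ∑ n ∈ Finset.Ioc 0 M, a n ≤ C * M := by
  induction M using Nat.strong_induction_on with
  | _ M ih =>
    rcases Nat.eq_zero_or_pos M with rfl | hM
    · simp
    · have h1 := ih (M / 2) (by omega)
      have h2 := h M hM
      rw [← Finset.sum_Ioc_consecutive a (Nat.zero_le (M / 2)) (by omega)]
      have h3 : ((M / 2 : ℕ) : ℝ) ≤ M / 2 := Nat.cast_div_le
      nlinarith

/-- The mean square of the coefficients is bounded. -/
lemma HasBoundedModel.sum_norm_sq_le {l : ℕ → ℂ} (h : HasBoundedModel l) :
    ∃ C : ℝ, 0 ≤ C ∧ ∀ M : ℕ, ∑ n ∈ Finset.Icc 1 M, ‖l n‖ ^ 2 ≤ C * M := by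
  obtain ⟨Φ, A, B, L, m, hA, hL, hm, hlow, -, hF⟩ := h
  refine ⟨B ^ 2 / (A * m ^ 2), by positivity, fun M => ?_⟩
  refine sum_norm_sq_le_of_dyadic (a := fun n => ‖l n‖ ^ 2) (fun M hM => ?_) (by positivity) M
  have hM0 : (0 : ℝ) < M := by exact_mod_cast hM
  -- At this height M/2 < n ≤ M corresponds to ny in [A, 2A], where Φ is bounded below.
  set y : ℝ := 2 * A / M with hy
  have hy0 : 0 < y := by positivity
  obtain ⟨F, hFc, hFB, hFn⟩ := hF y hy0
  have hbes := sum_norm_sq_fourierCoeff_le hFc hFB (Finset.Ioc (M / 2) M)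
  have hterm : ∀ n ∈ Finset.Ioc (M / 2) M, y * m ^ 2 * ‖l n‖ ^ 2 ≤
      ‖∫ x in (0 : ℝ)..1, F x * e (-(n * x))‖ ^ 2 := by
    intro n hn
    rw [Finset.mem_Ioc] at hn
    have hn1 : (M : ℝ) ≤ 2 * n := by
      have : M ≤ 2 * n := by omega
      exact_mod_cast this
    have hn2 : (n : ℝ) ≤ M := by exact_mod_cast hn.2
    have hmem : (n : ℝ) * y ∈ Set.Icc A (2 * A) := by
      rw [hy, Set.mem_Icc, mul_div_assoc', le_div_iff₀ hM0, div_le_iff₀ hM0]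
      constructor <;> nlinarith
    rw [hFn n (by omega), norm_mul, norm_mul, mul_pow, mul_pow, Complex.norm_real,
      Real.norm_of_nonneg (Real.sqrt_nonneg _), Real.sq_sqrt hy0.le]
    have := hlow _ hmem
    calc y * m ^ 2 * ‖l n‖ ^ 2 ≤ y * ‖Φ (n * y)‖ ^ 2 * ‖l n‖ ^ 2 := by gcongr
      _ = _ := by ring
  have hsum := (Finset.sum_le_sum hterm).trans hbes
  rw [← Finset.mul_sum] at hsum
  have hpos : 0 < y * m ^ 2 := by positivity
  calc _ ≤ B ^ 2 / (y * m ^ 2) := by rw [le_div_iff₀ hpos]; linarith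
    _ = _ := by rw [hy]; field_simp

lemma IsBump.eq_zero {V : ℝ → ℝ} (h : IsBump V) {u : ℝ} (hu : u ∉ Set.Icc (1 : ℝ) 2) : V u = 0 :=
  image_eq_zero_of_notMem_tsupport fun h' => hu (h.2 h')

lemma IsBump.exists_lipschitz {V : ℝ → ℝ} (h : IsBump V) :
    ∃ K : ℝ, 0 ≤ K ∧ ∀ u v, |V u - V v| ≤ K * |u - v| := by
  have hc : HasCompactSupport V := isCompact_Icc.of_isClosed_subset (isClosed_tsupport V) h.2
  obtain ⟨K, hK⟩ := h.1.lipschitzWith_of_hasCompactSupport hc (by simp)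
  exact ⟨K, K.2, fun u v => by simpa [Real.dist_eq] using hK.dist_le_mul u v⟩

/-- The quotient of a bump function by a function that is Lipschitz and bounded away from zero on
its support is Lipschitz. -/
lemma IsBump.exists_lipschitz_div {W : ℝ → ℝ} (hW : IsBump W) {Ψ : ℝ → ℂ} {L m : ℝ} (hm : 0 < m)
    (hL0 : 0 ≤ L) (hlow : ∀ u ∈ Set.Icc (1 : ℝ) 2, m ≤ ‖Ψ u‖)
    (hL : ∀ u ∈ Set.Icc (1 : ℝ) 2, ∀ v ∈ Set.Icc (1 : ℝ) 2, ‖Ψ u - Ψ v‖ ≤ L * |u - v|) :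
    ∃ K : ℝ, ∀ u v, ‖(W u : ℂ) / Ψ u - (W v : ℂ) / Ψ v‖ ≤ K * |u - v| := by
  obtain ⟨K, hK0, hK⟩ := hW.exists_lipschitz
  have hone : ∀ u ∈ Set.Icc (1 : ℝ) 2, ∀ v ∉ Set.Icc (1 : ℝ) 2,
      ‖(W u : ℂ) / Ψ u‖ ≤ K / m * |u - v| := by
    intro u hu v hv
    have h := hK u v
    rw [hW.eq_zero hv, sub_zero] at h
    rw [norm_div, Complex.norm_real, Real.norm_eq_abs]
    calc |W u| / ‖Ψ u‖ ≤ (K * |u - v|) / m := by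
          gcongr
          exact hlow u hu
      _ = _ := by ring
  have hWb : ∀ u ∈ Set.Icc (1 : ℝ) 2, |W u| ≤ 2 * K := by
    intro u hu
    have h := hK u 0
    rw [hW.eq_zero (u := 0) (by simp), sub_zero, sub_zero, abs_of_nonneg (a := u)
      (by linarith [hu.1])] at h
    nlinarith [hu.2]
  have hmono : ∀ u v : ℝ, K / m * |u - v| ≤ (K / m + 2 * K * L / m ^ 2) * |u - v| := by
    intro u v
    gcongr
    have : 0 ≤ 2 * K * L / m ^ 2 := by positivity
    linarith
  refine ⟨K / m + 2 * K * L / m ^ 2, fun u v => ?_⟩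
  by_cases hu : u ∈ Set.Icc (1 : ℝ) 2 <;> by_cases hv : v ∈ Set.Icc (1 : ℝ) 2
  · have hu' := hlow u hu
    have hv' := hlow v hv
    have hu0 : Ψ u ≠ 0 := norm_pos_iff.mp (hm.trans_le hu')
    have hv0 : Ψ v ≠ 0 := norm_pos_iff.mp (hm.trans_le hv')
    have heq : (W u : ℂ) / Ψ u - (W v : ℂ) / Ψ v =
        ((W u - W v : ℝ) : ℂ) / Ψ u + (W v : ℂ) * (Ψ v - Ψ u) / (Ψ u * Ψ v) := by
      push_cast
      field_simp
      ring
    rw [heq]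
    refine (norm_add_le _ _).trans ?_
    rw [norm_div, norm_div, norm_mul, norm_mul, Complex.norm_real, Complex.norm_real,
      Real.norm_eq_abs, Real.norm_eq_abs]
    have h1 : |W u - W v| / ‖Ψ u‖ ≤ (K * |u - v|) / m := by gcongr; exact hK u v
    have h2 : |W v| * ‖Ψ v - Ψ u‖ / (‖Ψ u‖ * ‖Ψ v‖) ≤ (2 * K) * (L * |u - v|) / (m * m) := by
      gcongr
      · exact hWb v hv
      · rw [norm_sub_rev]; exact hL u hu v hv
    calc _ ≤ (K * |u - v|) / m + (2 * K) * (L * |u - v|) / (m * m) := add_le_add h1 h2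
      _ = _ := by ring
  · rw [hW.eq_zero hv, Complex.ofReal_zero, zero_div, sub_zero]
    exact (hone u hu v hv).trans (hmono u v)
  · rw [hW.eq_zero hu, Complex.ofReal_zero, zero_div, zero_sub, norm_neg, abs_sub_comm]
    exact (hone v hv u hu).trans (hmono v u)
  · rw [hW.eq_zero hu, hW.eq_zero hv]
    simp
    positivity

/-- Reflection and translation preserve the integral of a 1-periodic function over a period. This
makes the bound for twisted sums uniform in α. -/
lemma integral_norm_trigSum_sub (s : Finset ℕ) (a : ℕ → ℂ) (α : ℝ) :
    ∫ x in (0 : ℝ)..1, ‖∑ n ∈ s, a n * e (n * (α - x))‖ =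
      ∫ x in (0 : ℝ)..1, ‖∑ n ∈ s, a n * e (n * x)‖ := by
  set T : ℝ → ℝ := fun x => ‖∑ n ∈ s, a n * e (n * x)‖
  have hper : Function.Periodic T 1 := by
    intro x
    change ‖_‖ = ‖_‖
    congr 1
    refine Finset.sum_congr rfl fun n _ => ?_
    have := e_int n
    rw [mul_add, mul_one, e_add, show ((n : ℝ)) = ((n : ℤ) : ℝ) by simp, this, mul_one]
  have h := intervalIntegral.integral_comp_sub_left (a := 0) (b := 1) T α
  change ∫ x in (0 : ℝ)..1, T (α - x) = _
  rw [h]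
  have h2 := hper.intervalIntegral_add_eq (α - 1) 0
  simpa using h2

/-- Wilton's bound: square-root cancellation in additive twists, uniformly in the twist. -/
lemma HasBoundedModel.norm_twisted_sum_le {l : ℕ → ℂ} (h : HasBoundedModel l) {W : ℝ → ℝ}
    (hW : IsBump W) :
    ∃ C : ℝ, 0 ≤ C ∧ ∀ N : ℝ, 1 ≤ N → ∀ α : ℝ,
      ‖∑ n ∈ Finset.Icc 1 ⌊2 * N⌋₊, l n * (W (n / N) : ℂ) * e (n * α)‖ ≤ C * Real.sqrt N := by
  obtain ⟨Φ, A, B, L, m, hA, hL, hm, hlow, hlip, hF⟩ := h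
  have hmem : ∀ u ∈ Set.Icc (1 : ℝ) 2, A * u ∈ Set.Icc A (2 * A) := fun u hu =>
    ⟨by nlinarith [hu.1], by nlinarith [hu.2]⟩
  obtain ⟨K, hK⟩ := hW.exists_lipschitz_div (Ψ := fun u => Φ (A * u)) (L := L * A) hm
    (by positivity) (fun u hu => hlow _ (hmem u hu)) (fun u hu v hv => by
      refine (hlip _ (hmem u hu) _ (hmem v hv)).trans_eq ?_
      rw [← mul_sub, abs_mul, abs_of_pos hA]; ring)
  set G : ℝ → ℂ := fun u => (W u : ℂ) / Φ (A * u) with hG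
  have hB0 : 0 ≤ B := by
    obtain ⟨F, -, hFB, -⟩ := hF 1 one_pos
    exact (norm_nonneg _).trans (hFB 0)
  refine ⟨B * (6 * K ^ 2 + 1) / Real.sqrt A, by positivity, fun N hN α => ?_⟩
  have hN0 : 0 < N := by linarith
  set y := A / N with hy
  have hy0 : 0 < y := by positivity
  obtain ⟨F, hFc, hFB, hFn⟩ := hF y hy0
  have hsy : 0 < Real.sqrt y := Real.sqrt_pos.mpr hy0
  -- The twisted sum is a convolution of F with the kernel of G, evaluated at α; the factor Φ(ny)
  -- cancels the denominator of G since ny = A(n/N).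
  have hsum : (Real.sqrt y : ℂ) *
      ∑ n ∈ Finset.Icc 1 ⌊2 * N⌋₊, l n * (W (n / N) : ℂ) * e (n * α) =
      ∫ x in (0 : ℝ)..1, F x * ∑ n ∈ Finset.Icc 1 ⌊2 * N⌋₊, G (n / N) * e (n * (α - x)) := by
    have h1 : ∀ x : ℝ, ∑ n ∈ Finset.Icc 1 ⌊2 * N⌋₊, G (n / N) * e (n * (α - x)) =
        ∑ n ∈ Finset.Icc 1 ⌊2 * N⌋₊, (G (n / N) * e (n * α)) * e (-(n * x)) := by
      intro x
      refine Finset.sum_congr rfl fun n _ => ?_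
      rw [mul_assoc, ← e_add]
      congr 2; ring
    simp_rw [h1]
    rw [integral_mul_trigSum hFc, Finset.mul_sum]
    refine Finset.sum_congr rfl fun n hn => ?_
    rw [Finset.mem_Icc] at hn
    rw [hFn n hn.1, hG, hy, show (n : ℝ) * (A / N) = A * (n / N) by ring]
    by_cases hu : (n : ℝ) / N ∈ Set.Icc (1 : ℝ) 2
    · have h0 : Φ (A * (n / N)) ≠ 0 := norm_pos_iff.mp (hm.trans_le (hlow _ (hmem _ hu)))
      beta_reduce
      generalize Φ (A * (n / N)) = w at h0 ⊢
      field_simp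
    · simp [hW.eq_zero hu]
  have hb := norm_integral_mul_le hFc
    (T := fun x => ∑ n ∈ Finset.Icc 1 ⌊2 * N⌋₊, G (n / N) * e (n * (α - x))) (by fun_prop) hFB
  rw [← hsum, integral_norm_trigSum_sub _ (fun n : ℕ => G (n / N)), norm_mul, Complex.norm_real,
    Real.norm_of_nonneg hsy.le] at hb
  have hker := integral_norm_kernel_le (G := G) (L := K)
    (fun u hu => by simp [hG, hW.eq_zero hu]) hK (N := N) (by linarith)
  have hfin := hb.trans (mul_le_mul_of_nonneg_left hker hB0)
  have hsA : 0 < Real.sqrt A := Real.sqrt_pos.mpr hA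
  have hsN : 0 < Real.sqrt N := Real.sqrt_pos.mpr hN0
  rw [hy, Real.sqrt_div hA.le] at hfin
  rw [div_mul_eq_mul_div, le_div_iff₀ hsA]
  rw [div_mul_eq_mul_div, div_le_iff₀ hsN] at hfin
  linarith

/-! ### Holomorphic forms have bounded models -/

lemma e_neg_eq_mul_inv_qParam (n : ℕ) (x y : ℝ) :
    e (-(n * x)) = (Real.exp (-(2 * Real.pi * (n * y))) : ℂ) *
      (1 / Function.Periodic.qParam 1 ((x : ℂ) + y * Complex.I) ^ n) := by
  rw [e, Function.Periodic.qParam, one_div, ← Complex.exp_nat_mul, ← Complex.exp_neg,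
    Complex.ofReal_exp, ← Complex.exp_add]
  congr 1
  push_cast
  linear_combination (2 * Real.pi * n * y : ℂ) * Complex.I_sq

/-- The factor y^(k/2) that makes f bounded combines with the normalisation n^((k-1)/2) into √y
times a function of ny alone, as `HasBoundedModel` requires. -/
lemma rpow_height_split {n y : ℝ} (hn : 0 < n) (hy : 0 < y) (k : ℝ) :
    y ^ (k / 2) * n ^ ((k - 1) / 2) = Real.sqrt y * (n * y) ^ ((k - 1) / 2) := by
  rw [Real.mul_rpow hn.le hy.le, Real.sqrt_eq_rpow, mul_left_comm, ← Real.rpow_add hy]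
  ring_nf

/-- Coefficients of holomorphic cusp forms of level one. -/
lemma IsHolomorphicHeckeCoeff.hasBoundedModel {l : ℕ → ℂ} (h : IsHolomorphicHeckeCoeff l) :
    HasBoundedModel l := by
  obtain ⟨k, f, -, hcoeff, -⟩ := h
  set φ : ℝ → ℝ := fun u => u ^ (((k : ℝ) - 1) / 2) * Real.exp (-(2 * Real.pi * u)) with hφ
  have hφs : ContDiffOn ℝ 1 φ (Set.Icc 1 2) := by
    intro u hu
    have hu0 : u ≠ 0 := by have := hu.1; positivity
    exact ((Real.contDiffAt_rpow_const_of_ne hu0).mul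
      (Real.contDiff_exp.contDiffAt.comp u (by fun_prop))).contDiffWithinAt
  obtain ⟨L, hL⟩ := hφs.exists_lipschitzOnWith one_ne_zero (convex_Icc 1 2) isCompact_Icc
  obtain ⟨u₀, hu₀, hmin⟩ := isCompact_Icc.exists_isMinOn
    (Set.nonempty_Icc.mpr one_le_two) hφs.continuousOn
  have hpos : ∀ u ∈ Set.Icc (1 : ℝ) 2, 0 < φ u := fun u hu => by
    have : 0 < u := by linarith [hu.1]
    positivity
  obtain ⟨C, hC⟩ := CuspFormClass.exists_bound f
  refine ⟨fun u => (φ u : ℂ), 1, C, L, φ u₀, one_pos, L.2, hpos _ hu₀, ?_, ?_, ?_⟩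
  · intro u hu
    rw [mul_one] at hu
    rw [Complex.norm_real, Real.norm_of_nonneg (hpos u hu).le]
    exact hmin hu
  · intro u hu v hv
    rw [mul_one] at hu hv
    rw [← Complex.ofReal_sub, Complex.norm_real]
    simpa [Real.dist_eq] using hL.dist_le_mul u hu v hv
  · intro y hy
    have him : ∀ x : ℝ, 0 < ((x : ℂ) + y * Complex.I).im := fun x => by simpa using hy
    refine ⟨fun x => ((y ^ ((k : ℝ) / 2) : ℝ) : ℂ) * f ⟨(x : ℂ) + y * Complex.I, him x⟩, ?_, ?_, ?_⟩
    · have hf : Continuous f := (ModularFormClass.holo f).continuous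
      have : Continuous fun x : ℝ => (⟨(x : ℂ) + y * Complex.I, him x⟩ : ℍ) := by fun_prop
      fun_prop
    · intro x
      have h1 := hC ⟨(x : ℂ) + y * Complex.I, him x⟩
      have h2 : UpperHalfPlane.im ⟨(x : ℂ) + y * Complex.I, him x⟩ = y := by
        simp [← UpperHalfPlane.coe_im]
      rw [h2, le_div_iff₀ (by positivity)] at h1
      rw [norm_mul, Complex.norm_real, Real.norm_of_nonneg (by positivity), mul_comm]
      exact h1
    · intro n hn
      have hn0 : (0 : ℝ) < n := by exact_mod_cast hn
      have hq := ModularFormClass.qExpansion_coeff_eq_intervalIntegral f (h := 1) one_pos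
        one_mem_strictPeriods_SL n hy
      rw [hcoeff n hn] at hq
      simp only [Complex.ofReal_one, div_one, one_mul] at hq
      have h1 : ∀ x : ℝ, ((y ^ ((k : ℝ) / 2) : ℝ) : ℂ) * f ⟨(x : ℂ) + y * Complex.I, him x⟩ *
          e (-(n * x)) =
          (((y ^ ((k : ℝ) / 2) : ℝ) : ℂ) * (Real.exp (-(2 * Real.pi * (n * y))) : ℂ)) *
          (1 / Function.Periodic.qParam 1 ((x : ℂ) + y * Complex.I) ^ n *
            f ⟨(x : ℂ) + y * Complex.I, him x⟩) := by
        intro x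
        rw [e_neg_eq_mul_inv_qParam n x y]
        ring
      simp_rw [h1]
      rw [intervalIntegral.integral_const_mul]
      erw [← hq]
      have h2 := congrArg (fun r : ℝ => (r : ℂ)) (rpow_height_split hn0 hy (k : ℝ))
      simp only [Complex.ofReal_mul] at h2
      simp only [hφ, Complex.ofReal_mul]
      linear_combination (l n * (Real.exp (-(2 * Real.pi * (n * y))) : ℂ)) * h2

/-! ### Upper, lower and Lipschitz bounds for the K-Bessel function -/

/-- Since cosh t ≥ t²/4, completing the square leaves a Gaussian majorant. -/
lemma integrableOn_exp_cosh {y : ℝ} (hy : 0 < y) (a : ℝ) :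
    IntegrableOn (fun t : ℝ => Real.exp (-(y * Real.cosh t)) * Real.exp (a * t)) (Set.Ioi 0) := by
  have hg : IntegrableOn (fun t : ℝ => Real.exp (2 * a ^ 2 / y) * Real.exp (-(y / 8) * t ^ 2))
      (Set.Ioi 0) :=
    ((integrable_exp_neg_mul_sq (by positivity : 0 < y / 8)).const_mul _).integrableOn
  refine Integrable.mono' hg (Continuous.aestronglyMeasurable (by fun_prop)) ?_
  filter_upwards [ae_restrict_mem measurableSet_Ioi] with t ht
  have ht : 0 < t := ht
  rw [Real.norm_of_nonneg (by positivity), ← Real.exp_add, ← Real.exp_add]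
  refine Real.exp_le_exp.mpr ?_
  have h1 : t ^ 2 / 4 ≤ Real.cosh t := by
    rw [Real.cosh_eq]
    have := Real.quadratic_le_exp_of_nonneg ht.le
    have := Real.exp_pos (-t)
    linarith
  have h2 : 2 * a ^ 2 / y + y / 8 * t ^ 2 - a * t = (4 * a - y * t) ^ 2 / (8 * y) := by
    field_simp; ring
  have h3 : 0 ≤ (4 * a - y * t) ^ 2 / (8 * y) := by positivity
  have h4 := mul_le_mul_of_nonneg_left h1 hy.le
  linarith

lemma norm_ccosh_mul_le (s : ℂ) {t : ℝ} (ht : 0 ≤ t) :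
    ‖Complex.cosh (s * t)‖ ≤ Real.exp (‖s‖ * t) := by
  have h : ‖s * (t : ℂ)‖ = ‖s‖ * t := by
    rw [norm_mul, Complex.norm_real, Real.norm_of_nonneg ht]
  have h1 := Complex.norm_exp_le_exp_norm (s * t)
  have h2 := Complex.norm_exp_le_exp_norm (-(s * t))
  rw [norm_neg] at h2
  rw [h] at h1 h2
  rw [Complex.cosh, norm_div, Complex.norm_ofNat]
  have := norm_add_le (Complex.exp (s * t)) (Complex.exp (-(s * t)))
  linarith

lemma norm_besselK_integrand_le (s : ℂ) (y : ℝ) {t : ℝ} (ht : 0 ≤ t) :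
    ‖((Real.exp (-(y * Real.cosh t)) : ℝ) : ℂ) * Complex.cosh (s * (t : ℂ))‖ ≤
      Real.exp (-(y * Real.cosh t)) * Real.exp (‖s‖ * t) := by
  rw [norm_mul, Complex.norm_real, Real.norm_of_nonneg (Real.exp_pos _).le]
  gcongr
  exact norm_ccosh_mul_le s ht

lemma integrableOn_besselK (s : ℂ) {y : ℝ} (hy : 0 < y) :
    IntegrableOn (fun t : ℝ => ((Real.exp (-(y * Real.cosh t)) : ℝ) : ℂ) *
      Complex.cosh (s * (t : ℂ))) (Set.Ioi 0) := by
  refine Integrable.mono' (integrableOn_exp_cosh hy ‖s‖)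
    (Continuous.aestronglyMeasurable (by fun_prop)) ?_
  filter_upwards [ae_restrict_mem measurableSet_Ioi] with t ht
  exact norm_besselK_integrand_le s y (le_of_lt ht)

/-- Exponential decay of the K-Bessel function. -/
lemma exists_norm_besselK_le (s : ℂ) :
    ∃ C : ℝ, 0 ≤ C ∧ ∀ y : ℝ, 1 ≤ y → ‖besselK s y‖ ≤ C * Real.exp (-y) := by
  set C₁ := ∫ t in Set.Ioi (0 : ℝ), Real.exp (-(1 * Real.cosh t)) * Real.exp (‖s‖ * t)
  have hC₁ : 0 ≤ C₁ := setIntegral_nonneg measurableSet_Ioi fun t _ => by positivity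
  refine ⟨C₁ * Real.exp 1, by positivity, fun y hy => ?_⟩
  have h := norm_integral_le_of_norm_le ((integrableOn_exp_cosh one_pos ‖s‖).const_mul
    (Real.exp (1 - y))) (f := fun t : ℝ => ((Real.exp (-(y * Real.cosh t)) : ℝ) : ℂ) *
      Complex.cosh (s * (t : ℂ))) (μ := volume.restrict (Set.Ioi 0)) (by
      filter_upwards [ae_restrict_mem measurableSet_Ioi] with t ht
      refine (norm_besselK_integrand_le s y (le_of_lt ht)).trans ?_
      simp only [← Real.exp_add]
      refine Real.exp_le_exp.mpr ?_
      nlinarith [Real.one_le_cosh t])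
  rw [integral_const_mul] at h
  refine h.trans_eq ?_
  rw [sub_eq_add_neg, Real.exp_add]
  ring

lemma abs_exp_neg_sub_exp_neg_le {p q r : ℝ} (hp : r ≤ p) (hq : r ≤ q) :
    |Real.exp (-p) - Real.exp (-q)| ≤ Real.exp (-r) * |p - q| := by
  wlog h : p ≤ q generalizing p q
  · rw [abs_sub_comm, abs_sub_comm p q]
    exact this hq hp (le_of_not_ge h)
  have h1 : Real.exp (-q) = Real.exp (-p) * Real.exp (-(q - p)) := by
    rw [← Real.exp_add]; ring_nf
  have h2 := Real.add_one_le_exp (-(q - p))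
  have h3 : Real.exp (-q) ≤ Real.exp (-p) := Real.exp_le_exp.mpr (by linarith)
  have h4 : Real.exp (-p) ≤ Real.exp (-r) := Real.exp_le_exp.mpr (by linarith)
  rw [abs_of_nonneg (by linarith), abs_sub_comm, abs_of_nonneg (by linarith), h1]
  have h5 := Real.exp_pos (-p)
  calc Real.exp (-p) - Real.exp (-p) * Real.exp (-(q - p)) ≤ Real.exp (-p) * (q - p) := by
        nlinarith
    _ ≤ _ := by gcongr

/-- The K-Bessel function is Lipschitz away from zero. -/
lemma exists_besselK_lipschitz (s : ℂ) {A : ℝ} (hA : 0 < A) :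
    ∃ L : ℝ, 0 ≤ L ∧ ∀ u v : ℝ, A ≤ u → A ≤ v →
      ‖besselK s u - besselK s v‖ ≤ L * |u - v| := by
  -- Differencing in the argument brings down a factor cosh t ≤ exp t, hence the exponent ‖s‖ + 1.
  refine ⟨∫ t in Set.Ioi (0 : ℝ), Real.exp (-(A * Real.cosh t)) * Real.exp ((‖s‖ + 1) * t),
    setIntegral_nonneg measurableSet_Ioi fun t _ => by positivity, fun u v hu hv => ?_⟩
  rw [besselK, besselK, ← integral_sub (integrableOn_besselK s (by linarith))
    (integrableOn_besselK s (by linarith)), mul_comm, ← integral_const_mul]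
  refine norm_integral_le_of_norm_le ((integrableOn_exp_cosh hA (‖s‖ + 1)).const_mul _) ?_
  filter_upwards [ae_restrict_mem measurableSet_Ioi] with t ht
  have ht : 0 < t := ht
  have hc := Real.one_le_cosh t
  rw [← sub_mul, ← Complex.ofReal_sub, norm_mul, Complex.norm_real, Real.norm_eq_abs]
  have h1 := abs_exp_neg_sub_exp_neg_le (p := u * Real.cosh t) (q := v * Real.cosh t)
    (r := A * Real.cosh t) (by gcongr) (by gcongr)
  rw [← sub_mul, abs_mul, abs_of_pos (a := Real.cosh t) (by linarith)] at h1
  have h2 : Real.cosh t ≤ Real.exp t := by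
    rw [Real.cosh_eq]
    have : Real.exp (-t) ≤ Real.exp t := Real.exp_le_exp.mpr (by linarith)
    linarith
  calc _ ≤ (Real.exp (-(A * Real.cosh t)) * (|u - v| * Real.exp t)) * Real.exp (‖s‖ * t) := by
        gcongr
        · exact h1.trans (by gcongr)
        · exact norm_ccosh_mul_le s ht.le
    _ = _ := by rw [add_mul, one_mul, Real.exp_add]; ring

/-- By continuity from cosh 0 = 1. Near t = 0, where the integral for K concentrates at large
argument, there is then no cancellation. -/
lemma exists_half_le_re_ccosh (s : ℂ) :
    ∃ δ : ℝ, 0 < δ ∧ ∀ t : ℝ, 0 ≤ t → t ≤ δ → 1 / 2 ≤ (Complex.cosh (s * t)).re := by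
  have hc : Continuous fun t : ℝ => (Complex.cosh (s * t)).re := by fun_prop
  have h0 : (1 / 2 : ℝ) < (Complex.cosh (s * (0 : ℝ))).re := by norm_num
  obtain ⟨δ, hδ, h⟩ := Metric.eventually_nhds_iff.mp (hc.continuousAt.eventually (lt_mem_nhds h0))
  refine ⟨δ / 2, by positivity, fun t ht0 ht => le_of_lt (h ?_)⟩
  rw [Real.dist_eq, sub_zero, abs_of_nonneg ht0]
  linarith

/-- The K-Bessel function does not decay faster than exponentially; in particular it has no large
zeros. -/
lemma exists_le_norm_besselK (s : ℂ) :
    ∃ p c u₀ : ℝ, 0 < p ∧ 0 < c ∧ ∀ u : ℝ, u₀ ≤ u → c * Real.exp (-(p * u)) ≤ ‖besselK s u‖ := by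
  obtain ⟨δ, hδ, hre⟩ := exists_half_le_re_ccosh s
  -- The range t ≤ δ/2 contributes at least (δ/4) exp(-pu), the range up to δ is nonnegative, and
  -- the tail is O(exp(-qu)). As p < q, the first dominates for large u.
  set p := Real.cosh (δ / 2) with hp
  set q := Real.cosh δ with hq
  have hp0 : 0 < p := Real.cosh_pos _
  have hpq : p < q := by
    rw [hp, hq, Real.cosh_lt_cosh, abs_of_pos (by positivity), abs_of_pos hδ]
    linarith
  set C := ∫ t in Set.Ioi (0 : ℝ), Real.exp (-(1 * Real.cosh t)) * Real.exp (‖s‖ * t)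
  have hC : 0 ≤ C := setIntegral_nonneg measurableSet_Ioi fun t _ => by positivity
  have key : ∀ u : ℝ, 1 ≤ u →
      δ / 4 * Real.exp (-(p * u)) - Real.exp (-((u - 1) * q)) * C ≤ ‖besselK s u‖ := by
    intro u hu
    refine le_trans ?_ (Complex.re_le_norm _)
    have hint := integrableOn_besselK s (y := u) (by linarith)
    have hre_int : (besselK s u).re = ∫ t in Set.Ioi (0 : ℝ),
        Real.exp (-(u * Real.cosh t)) * (Complex.cosh (s * (t : ℂ))).re := by
      rw [besselK]
      have := integral_re hint
      simp only [RCLike.re_eq_complex_re, Complex.re_ofReal_mul] at this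
      exact this.symm
    have hind : IntegrableOn ((Set.Ioc (0 : ℝ) (δ / 2)).indicator
        fun _ => 1 / 2 * Real.exp (-(p * u))) (Set.Ioi 0) := by
      refine Integrable.integrableOn ?_
      rw [integrable_indicator_iff measurableSet_Ioc]
      exact integrableOn_const (by simp)
    have hg := (integrableOn_exp_cosh one_pos ‖s‖).const_mul (Real.exp (-((u - 1) * q)))
    have hval : ∫ t in Set.Ioi (0 : ℝ), ((Set.Ioc (0 : ℝ) (δ / 2)).indicator
        (fun _ => 1 / 2 * Real.exp (-(p * u))) t - Real.exp (-((u - 1) * q)) *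
          (Real.exp (-(1 * Real.cosh t)) * Real.exp (‖s‖ * t))) =
        δ / 4 * Real.exp (-(p * u)) - Real.exp (-((u - 1) * q)) * C := by
      rw [integral_sub hind hg, integral_const_mul, setIntegral_indicator measurableSet_Ioc,
        Set.inter_eq_self_of_subset_right Set.Ioc_subset_Ioi_self, setIntegral_const]
      simp only [smul_eq_mul, Real.volume_real_Ioc, sub_zero]
      rw [max_eq_left (by positivity)]
      ring
    rw [hre_int, ← hval]
    have hre_int' : IntegrableOn (fun t : ℝ =>
        Real.exp (-(u * Real.cosh t)) * (Complex.cosh (s * (t : ℂ))).re) (Set.Ioi 0) := by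
      have := hint.re
      simp only [RCLike.re_eq_complex_re, Complex.re_ofReal_mul] at this
      exact this
    refine setIntegral_mono_on (hind.sub hg) hre_int' measurableSet_Ioi fun t ht => ?_
    have ht : 0 < t := ht
    have hgt : 0 ≤ Real.exp (-((u - 1) * q)) *
      (Real.exp (-(1 * Real.cosh t)) * Real.exp (‖s‖ * t)) := by positivity
    rcases le_or_gt t (δ / 2) with h1 | h1
    · rw [Set.indicator_of_mem (Set.mem_Ioc.mpr ⟨ht, h1⟩)]
      have h2 := hre t ht.le (by linarith)
      have h3 : Real.exp (-(p * u)) ≤ Real.exp (-(u * Real.cosh t)) := by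
        refine Real.exp_le_exp.mpr ?_
        have : Real.cosh t ≤ p := by
          rw [hp, Real.cosh_le_cosh, abs_of_pos ht, abs_of_pos (by positivity)]; exact h1
        nlinarith
      have h4 := Real.exp_pos (-(u * Real.cosh t))
      nlinarith
    · rw [Set.indicator_of_notMem (fun h => absurd h.2 (not_le.mpr h1))]
      rcases le_or_gt t δ with h5 | h5
      · have h2 := hre t ht.le h5
        have h4 := Real.exp_pos (-(u * Real.cosh t))
        nlinarith
      · have h6 := norm_besselK_integrand_le s u ht.le
        have h7 := (Complex.abs_re_le_norm _).trans h6
        rw [Complex.re_ofReal_mul] at h7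
        have h8 : Real.exp (-(u * Real.cosh t)) * Real.exp (‖s‖ * t) ≤
            Real.exp (-((u - 1) * q)) * (Real.exp (-(1 * Real.cosh t)) * Real.exp (‖s‖ * t)) := by
          simp only [← Real.exp_add]
          refine Real.exp_le_exp.mpr ?_
          have : q ≤ Real.cosh t := by
            rw [hq, Real.cosh_le_cosh, abs_of_pos ht, abs_of_pos hδ]; exact h5.le
          nlinarith
        have h9 := (abs_le.mp h7).1
        linarith
  have hlim : Filter.Tendsto (fun u : ℝ => C * Real.exp q * Real.exp (-((q - p) * u)))
      Filter.atTop (nhds 0) := by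
    have h1 : Filter.Tendsto (fun u : ℝ => (q - p) * u) Filter.atTop Filter.atTop :=
      Filter.Tendsto.const_mul_atTop (by linarith) Filter.tendsto_id
    simpa using (Real.tendsto_exp_neg_atTop_nhds_zero.comp h1).const_mul (C * Real.exp q)
  obtain ⟨u₁, hu₁⟩ := Filter.eventually_atTop.mp
    (hlim.eventually (gt_mem_nhds (by positivity : (0 : ℝ) < δ / 8)))
  refine ⟨p, δ / 8, max u₁ 1, hp0, by positivity, fun u hu => ?_⟩
  have h1 := key u (le_trans (le_max_right _ _) hu)
  have h2 := (hu₁ u (le_trans (le_max_left _ _) hu)).le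
  have h3 : Real.exp (-((u - 1) * q)) * C =
      (C * Real.exp q * Real.exp (-((q - p) * u))) * Real.exp (-(p * u)) := by
    have : Real.exp (-((u - 1) * q)) =
        Real.exp q * Real.exp (-((q - p) * u)) * Real.exp (-(p * u)) := by
      rw [← Real.exp_add, ← Real.exp_add]; ring_nf
    rw [this]; ring
  have h4 := mul_le_mul_of_nonneg_right h2 (Real.exp_pos (-(p * u))).le
  linarith

/-! ### Maass forms have bounded models -/

/-- The term of index `n` in the Fourier expansion of a weight zero form at height `y`, without
its exponential. -/
def maassCoeff (ν : ℂ) (c : ℤ → ℂ) (y : ℝ) (n : ℤ) : ℂ :=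
  ((Real.sqrt y : ℝ) : ℂ) * c n * besselK (Complex.I * ν) (2 * Real.pi * |(n : ℝ)| * y)

/-- A convergent Fourier-Bessel expansion is bounded at the cusp. -/
lemma isBoundedAtImInfty_of_hasSum {ν : ℂ} {f : ℍ → ℂ} {c : ℤ → ℂ}
    (hf : ∀ z : ℍ, HasSum (fun n : {n : ℤ // n ≠ 0} => maassCoeff ν c z.im n * e (n * z.re))
      (f z)) : IsBoundedAtImInfty f := by
  obtain ⟨C, hC0, hC⟩ := exists_norm_besselK_le (Complex.I * ν)
  obtain ⟨p, b, u₀, hp, hb, hlow⟩ := exists_le_norm_besselK (Complex.I * ν)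
  have hpi := Real.pi_gt_three
  set y₁ : ℝ := max u₀ 1 with hy₁
  have hy₁1 : 1 ≤ y₁ := le_max_right _ _
  have hy₁0 : 0 < y₁ := by linarith
  have hsum := (hf ⟨Complex.I * y₁, by simpa using hy₁0⟩).summable.norm
  have him : UpperHalfPlane.im ⟨Complex.I * y₁, by simpa using hy₁0⟩ = y₁ := by
    simp [← UpperHalfPlane.coe_im]
  simp only [norm_mul, norm_e, mul_one, him] at hsum
  have habs : ∀ n : {n : ℤ // n ≠ 0}, 1 ≤ |((n : ℤ) : ℝ)| := fun n => by
    exact_mod_cast Int.one_le_abs n.2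
  -- Convergence at the single height y₁, together with the lower bound for K, limits the growth of
  -- c(n) to exponential.
  have hsum2 : Summable fun n : {n : ℤ // n ≠ 0} =>
      ‖c n‖ * Real.exp (-(p * (2 * Real.pi * |((n : ℤ) : ℝ)| * y₁))) := by
    refine Summable.of_nonneg_of_le (fun n => by positivity) (fun n => ?_) (hsum.mul_left b⁻¹)
    have h1 : u₀ ≤ 2 * Real.pi * |((n : ℤ) : ℝ)| * y₁ := by
      have h2 : 1 ≤ 2 * Real.pi * |((n : ℤ) : ℝ)| := by nlinarith [habs n]
      calc u₀ ≤ y₁ := le_max_left _ _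
        _ ≤ _ := by nlinarith
    have h3 := hlow _ h1
    have h4 : (1 : ℝ) ≤ Real.sqrt y₁ := Real.one_le_sqrt.mpr hy₁1
    rw [maassCoeff, norm_mul, norm_mul, Complex.norm_real, Real.norm_of_nonneg (by positivity)]
    calc _ = b⁻¹ * (1 * ‖c n‖ * (b * Real.exp (-(p * (2 * Real.pi * |((n : ℤ) : ℝ)| * y₁))))) := by
          field_simp
      _ ≤ _ := by gcongr
  refine isBoundedAtImInfty_iff.mpr
    ⟨C * Real.exp (p * y₁) * ∑' n : {n : ℤ // n ≠ 0},
      ‖c n‖ * Real.exp (-(p * (2 * Real.pi * |((n : ℤ) : ℝ)| * y₁))), p * y₁ + 1, fun z hz => ?_⟩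
  have hpy : 0 < p * y₁ := by positivity
  rw [← (hf z).tsum_eq, ← tsum_mul_left]
  refine tsum_of_norm_bounded (hsum2.mul_left (C * Real.exp (p * y₁))).hasSum fun n => ?_
  rw [norm_mul, norm_e, mul_one, maassCoeff, norm_mul, norm_mul, Complex.norm_real,
    Real.norm_of_nonneg (by positivity)]
  have hn := habs n
  have h1 : (1 : ℝ) ≤ 2 * Real.pi * |((n : ℤ) : ℝ)| * z.im := by
    have h2 : 1 ≤ 2 * Real.pi * |((n : ℤ) : ℝ)| := by nlinarith
    nlinarith
  have h3 := hC _ h1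
  have h4 : Real.sqrt z.im ≤ Real.exp z.im := by
    have h5 : Real.sqrt z.im ≤ z.im := (Real.sqrt_le_left (by linarith)).mpr (by nlinarith)
    linarith [Real.add_one_le_exp z.im]
  -- With t = 2π|n| ≥ 1 this is (t - 1) p y₁ ≤ (t - 1) Im z, which holds once Im z ≥ p y₁: the decay
  -- of K then beats the growth of c(n).
  have h6 : Real.exp z.im * Real.exp (-(2 * Real.pi * |((n : ℤ) : ℝ)| * z.im)) ≤
      Real.exp (p * y₁) * Real.exp (-(p * (2 * Real.pi * |((n : ℤ) : ℝ)| * y₁))) := by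
    rw [← Real.exp_add, ← Real.exp_add]
    refine Real.exp_le_exp.mpr ?_
    have h7 : 1 ≤ 2 * Real.pi * |((n : ℤ) : ℝ)| := by nlinarith
    nlinarith
  calc Real.sqrt z.im * ‖c n‖ * ‖besselK (Complex.I * ν) (2 * Real.pi * |((n : ℤ) : ℝ)| * z.im)‖
      ≤ Real.exp z.im * ‖c n‖ *
        (C * Real.exp (-(2 * Real.pi * |((n : ℤ) : ℝ)| * z.im))) := by gcongr
    _ = C * ‖c n‖ * (Real.exp z.im * Real.exp (-(2 * Real.pi * |((n : ℤ) : ℝ)| * z.im))) := by ring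
    _ ≤ C * ‖c n‖ *
        (Real.exp (p * y₁) * Real.exp (-(p * (2 * Real.pi * |((n : ℤ) : ℝ)| * y₁)))) := by gcongr
    _ = _ := by ring

lemma IsMaassCuspForm.continuous {ν : ℂ} {f : ℍ → ℂ} (hf : IsMaassCuspForm ν f) :
    Continuous f := by
  have h : Continuous fun z : ℍ => f (ofComplex (z : ℂ)) :=
    hf.smooth.continuousOn.comp_continuous UpperHalfPlane.continuous_coe fun z => z.im_pos
  simpa using h

/-- The Fourier coefficients of an absolutely convergent Fourier series. -/
lemma integral_mul_e_of_hasSum {F : ℝ → ℂ} {a : ℤ → ℂ}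
    (hF : ∀ x : ℝ, HasSum (fun n : {n : ℤ // n ≠ 0} => a n * e (n * x)) (F x)) {m : ℤ}
    (hm : m ≠ 0) : ∫ x in (0 : ℝ)..1, F x * e (-(m * x)) = a m := by
  -- Unconditional convergence in ℂ is absolute, so x = 0 supplies a majorant valid for all x.
  have hs : Summable fun n : {n : ℤ // n ≠ 0} => ‖a n‖ := by
    simpa [norm_mul, norm_e] using (hF 0).summable.norm
  have h := intervalIntegral.hasSum_integral_of_dominated_convergence (μ := volume)
    (a := 0) (b := 1) (F := fun (n : {n : ℤ // n ≠ 0}) x => a n * e (n * x) * e (-(m * x)))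
    (f := fun x => F x * e (-(m * x))) (fun n _ => ‖a n‖)
    (fun n => Continuous.aestronglyMeasurable (by fun_prop))
    (fun n => Filter.Eventually.of_forall fun x _ => by simp [norm_e])
    (Filter.Eventually.of_forall fun x _ => hs)
    (by simp)
    (Filter.Eventually.of_forall fun x _ => (hF x).mul_right _)
  have h1 : ∀ n : {n : ℤ // n ≠ 0}, ∫ x in (0 : ℝ)..1, a n * e (n * x) * e (-(m * x)) =
      if n = ⟨m, hm⟩ then a m else 0 := by
    intro n
    have h2 : ∀ x : ℝ, a n * e (n * x) * e (-(m * x)) = a n * e (((n : ℤ) - m : ℤ) * x) := by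
      intro x
      rw [mul_assoc, ← e_add]
      congr 2
      push_cast; ring
    simp_rw [h2]
    rw [intervalIntegral.integral_const_mul, integral_e_int]
    by_cases hnm : (n : ℤ) = m
    · simp [hnm, Subtype.ext_iff]
    · simp [hnm, sub_eq_zero, Subtype.ext_iff]
  simp_rw [h1] at h
  exact h.unique (hasSum_ite_eq _ _)

/-- Coefficients of Maass cusp forms of level one. -/
lemma IsMaassHeckeCoeff.hasBoundedModel {l : ℕ → ℂ} (h : IsMaassHeckeCoeff l) :
    HasBoundedModel l := by
  obtain ⟨ν, f, c, hf, -, hexp, -, hl⟩ := h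
  have hexp' : ∀ z : ℍ, HasSum
      (fun n : {n : ℤ // n ≠ 0} => maassCoeff ν c z.im n * e (n * z.re)) (f z) := by
    intro z
    convert hexp z using 2 with n
    rw [maassCoeff, e]
    push_cast
    ring_nf
  obtain ⟨B, hB⟩ := ModularGroup.exists_bound_of_invariant hf.continuous
    (isBoundedAtImInfty_of_hasSum hexp') hf.invariant
  obtain ⟨p, b, u₀, hp, hb, hlow⟩ := exists_le_norm_besselK (Complex.I * ν)
  have hpi := Real.pi_gt_three
  -- The window [A, 2A] lies beyond u₀, away from any zeros of the K-Bessel function.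
  set A : ℝ := max u₀ 1 with hA
  have hA1 : 1 ≤ A := le_max_right _ _
  obtain ⟨L, hL0, hL⟩ := exists_besselK_lipschitz (Complex.I * ν) (A := A) (by linarith)
  refine ⟨fun u => besselK (Complex.I * ν) (2 * Real.pi * u), A, B, L * (2 * Real.pi),
    b * Real.exp (-(p * (2 * Real.pi * (2 * A)))), by linarith, by positivity, by positivity,
    ?_, ?_, ?_⟩
  · intro u hu
    refine le_trans ?_ (hlow (2 * Real.pi * u) ?_)
    · have := hu.2
      gcongr
    · have h1 : u₀ ≤ A := le_max_left _ _
      have h2 := hu.1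
      nlinarith
  · intro u hu v hv
    have hu1 := hu.1
    have hv1 := hv.1
    refine (hL _ _ (by nlinarith) (by nlinarith)).trans_eq ?_
    rw [← mul_sub, abs_mul, abs_of_pos (by positivity : 0 < 2 * Real.pi)]
    ring
  · intro y hy
    have him : ∀ x : ℝ, 0 < ((x : ℂ) + y * Complex.I).im := fun x => by simpa using hy
    set Z : ℝ → ℍ := fun x => ⟨(x : ℂ) + y * Complex.I, him x⟩ with hZ
    have hZim : ∀ x, (Z x).im = y := fun x => by simp [hZ, ← UpperHalfPlane.coe_im]
    have hZre : ∀ x, (Z x).re = x := fun x => by simp [hZ, ← UpperHalfPlane.coe_re]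
    refine ⟨fun x => f (Z x), ?_, fun x => hB _, fun n hn => ?_⟩
    · have hfc := hf.continuous
      have : Continuous Z := by fun_prop
      exact hfc.comp this
    · have hF : ∀ x : ℝ, HasSum
          (fun n : {n : ℤ // n ≠ 0} => maassCoeff ν c y n * e (n * x)) (f (Z x)) := by
        intro x
        have := hexp' (Z x)
        rwa [hZim, hZre] at this
      have := integral_mul_e_of_hasSum hF (m := n) (by omega)
      rw [Int.cast_natCast] at this
      rw [this, maassCoeff, hl n hn]
      simp [mul_assoc]

lemma IsHeckeCoeff.hasBoundedModel {l : ℕ → ℂ} (h : IsHeckeCoeff l) : HasBoundedModel l :=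
  h.elim IsHolomorphicHeckeCoeff.hasBoundedModel IsMaassHeckeCoeff.hasBoundedModel

/-! ### Trilinear forms and three-term progressions -/

/-- A trilinear form along `j = 2 b - c` is controlled by the sup norm of the exponential sum in
`j` and the `ℓ²` norms of the other two sequences. -/
lemma norm_trilinear_le {J : Finset ℕ} {X : ℕ → ℂ} {R : ℝ}
    (hR : ∀ α : ℝ, ‖∑ j ∈ J, X j * e (j * α)‖ ≤ R) (s : Finset ℕ) (p q : ℕ → ℂ) :
    ‖∑ b ∈ s, ∑ c ∈ s, p b * q c * ∑ j ∈ J, (if (j : ℤ) = 2 * b - c then X j else 0)‖ ≤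
      R * (Real.sqrt (∑ b ∈ s, ‖p b‖ ^ 2) * Real.sqrt (∑ c ∈ s, ‖q c‖ ^ 2)) := by
  have hR0 : 0 ≤ R := (norm_nonneg _).trans (hR 0)
  -- The frequencies -2b and c make the total frequency j - 2b + c. As b ↦ -2b is injective,
  -- Parseval still returns the ℓ² norm of p.
  set P : ℝ → ℂ := fun α => ∑ b ∈ s, p b * e ((-2 * b : ℤ) * α) with hP
  set Q : ℝ → ℂ := fun α => ∑ c ∈ s, q c * e ((c : ℤ) * α) with hQ
  have hPc : Continuous P := by fun_prop
  have hQc : Continuous Q := by fun_prop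
  have hint : ∑ b ∈ s, ∑ c ∈ s, p b * q c * ∑ j ∈ J, (if (j : ℤ) = 2 * b - c then X j else 0) =
      ∫ α in (0 : ℝ)..1, (∑ j ∈ J, X j * e (j * α)) * (P α * Q α) := by
    have h1 : ∀ α : ℝ, (∑ j ∈ J, X j * e (j * α)) * (P α * Q α) =
        ∑ b ∈ s, ∑ c ∈ s, p b * q c *
          ((∑ j ∈ J, X j * e (j * α)) * e (-((2 * b - c : ℤ) * α))) := by
      intro α
      rw [hP, hQ, Finset.sum_mul_sum, Finset.mul_sum]
      refine Finset.sum_congr rfl fun b _ => ?_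
      rw [Finset.mul_sum]
      refine Finset.sum_congr rfl fun c _ => ?_
      rw [show -(((2 * b - c : ℤ) : ℝ) * α) = (-2 * b : ℤ) * α + (c : ℤ) * α by
        push_cast; ring, e_add]
      ring
    simp_rw [h1]
    rw [intervalIntegral.integral_finsetSum
      (fun i _ => Continuous.intervalIntegrable (by fun_prop) _ _)]
    refine Finset.sum_congr rfl fun b _ => ?_
    rw [intervalIntegral.integral_finsetSum
      (fun i _ => Continuous.intervalIntegrable (by fun_prop) _ _)]
    refine Finset.sum_congr rfl fun c _ => ?_
    rw [intervalIntegral.integral_const_mul, integral_trigSum_mul_e]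
  rw [hint]
  refine (norm_integral_mul_le (by fun_prop) (hPc.mul hQc) hR).trans ?_
  gcongr
  have hnorm : ∀ α, ‖(P * Q) α‖ = ‖P α‖ * ‖Q α‖ := fun α => norm_mul _ _
  simp_rw [hnorm]
  refine (integral_norm_mul_le_sqrt hPc hQc).trans_eq ?_
  rw [integral_norm_sq_trigSum s p (fun b => -2 * (b : ℤ)) (fun a _ b _ h => by simpa using h),
    integral_norm_sq_trigSum s q (fun c => (c : ℤ)) (fun a _ b _ h => by simpa using h)]

/-- The weighted trilinear form, with an additional weight along `h = c - b`. -/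
lemma norm_weighted_trilinear_le {J I : Finset ℕ} {X v : ℕ → ℂ} {R D : ℝ}
    (hR : ∀ α : ℝ, ‖∑ j ∈ J, X j * e (j * α)‖ ≤ R)
    (hD : ∫ β in (0 : ℝ)..1, ‖∑ h ∈ I, v h * e (h * β)‖ ≤ D) (s : Finset ℕ) (p q : ℕ → ℂ) :
    ‖∑ b ∈ s, ∑ c ∈ s, p b * q c * (∑ j ∈ J, (if (j : ℤ) = 2 * b - c then X j else 0)) *
        ∑ h ∈ I, (if (h : ℤ) = c - b then v h else 0)‖ ≤
      R * (Real.sqrt (∑ b ∈ s, ‖p b‖ ^ 2) * Real.sqrt (∑ c ∈ s, ‖q c‖ ^ 2)) * D := by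
  have hR0 : 0 ≤ R := (norm_nonneg _).trans (hR 0)
  set x : ℕ → ℕ → ℂ := fun b c => ∑ j ∈ J, (if (j : ℤ) = 2 * b - c then X j else 0)
  -- Twisting p and q by unimodular factors leaves their ℓ² norms unchanged, so the unweighted bound
  -- holds uniformly in β.
  set T : ℝ → ℂ := fun β =>
    ∑ b ∈ s, ∑ c ∈ s, (p b * e (b * β)) * (q c * e (-(c * β))) * x b c with hT
  have hTc : Continuous T := by fun_prop
  have hTb : ∀ β, ‖T β‖ ≤
      R * (Real.sqrt (∑ b ∈ s, ‖p b‖ ^ 2) * Real.sqrt (∑ c ∈ s, ‖q c‖ ^ 2)) := by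
    intro β
    have := norm_trilinear_le hR s (fun b => p b * e (b * β)) (fun c => q c * e (-(c * β)))
    simpa only [norm_mul, norm_e, mul_one] using this
  have hint : ∑ b ∈ s, ∑ c ∈ s, p b * q c * x b c *
      ∑ h ∈ I, (if (h : ℤ) = c - b then v h else 0) =
      ∫ β in (0 : ℝ)..1, T β * ∑ h ∈ I, v h * e (h * β) := by
    have h1 : ∀ β : ℝ, T β * ∑ h ∈ I, v h * e (h * β) =
        ∑ b ∈ s, ∑ c ∈ s, p b * q c * x b c *
          ((∑ h ∈ I, v h * e (h * β)) * e (-((c - b : ℤ) * β))) := by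
      intro β
      rw [hT, Finset.sum_mul]
      refine Finset.sum_congr rfl fun b _ => ?_
      rw [Finset.sum_mul]
      refine Finset.sum_congr rfl fun c _ => ?_
      rw [show -(((c - b : ℤ) : ℝ) * β) = b * β + -(c * β) by push_cast; ring, e_add]
      ring
    simp_rw [h1]
    rw [intervalIntegral.integral_finsetSum
      (fun i _ => Continuous.intervalIntegrable (by fun_prop) _ _)]
    refine Finset.sum_congr rfl fun b _ => ?_
    rw [intervalIntegral.integral_finsetSum
      (fun i _ => Continuous.intervalIntegrable (by fun_prop) _ _)]
    refine Finset.sum_congr rfl fun c _ => ?_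
    rw [intervalIntegral.integral_const_mul, integral_trigSum_mul_e]
  rw [hint]
  refine (norm_integral_mul_le hTc (by fun_prop) hTb).trans ?_
  gcongr

/-- Parametrising three-term progressions by their last two terms. -/
lemma sum_progressions_eq (v X p q : ℕ → ℂ) (K M : ℕ) :
    ∑ h ∈ Finset.Icc 1 K, v h * ∑ n ∈ Finset.Icc 1 M, X n * p (n + h) * q (n + 2 * h) =
      ∑ b ∈ Finset.Icc 1 (M + 2 * K), ∑ c ∈ Finset.Icc 1 (M + 2 * K), p b * q c *
        (∑ j ∈ Finset.Icc 1 M, (if (j : ℤ) = 2 * b - c then X j else 0)) *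
        ∑ h ∈ Finset.Icc 1 K, (if (h : ℤ) = c - b then v h else 0) := by
  set s := Finset.Icc 1 (M + 2 * K) with hs
  have h1 : ∀ h ∈ Finset.Icc 1 K, ∀ n ∈ Finset.Icc 1 M, p (n + h) * q (n + 2 * h) =
      ∑ b ∈ s, ∑ c ∈ s, p b * q c * ((if (n : ℤ) = 2 * b - c then 1 else 0) *
        (if (h : ℤ) = c - b then 1 else 0)) := by
    intro h hh n hn
    rw [Finset.mem_Icc] at hh hn
    rw [Finset.sum_eq_single_of_mem (n + h) (by rw [hs, Finset.mem_Icc]; omega),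
      Finset.sum_eq_single_of_mem (n + 2 * h) (by rw [hs, Finset.mem_Icc]; omega)]
    · rw [if_pos (by push_cast; ring), if_pos (by push_cast; ring)]
      ring
    · intro c _ hc
      rw [if_neg (c := (h : ℤ) = _) (by omega)]
      ring
    · intro b _ hb
      refine Finset.sum_eq_zero fun c _ => ?_
      by_cases h2 : (n : ℤ) = 2 * b - c
      · rw [if_neg (c := (h : ℤ) = _) (by omega)]
        ring
      · rw [if_neg h2]
        ring
  calc _ = ∑ h ∈ Finset.Icc 1 K, ∑ n ∈ Finset.Icc 1 M, ∑ b ∈ s, ∑ c ∈ s, p b * q c *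
        (if (n : ℤ) = 2 * b - c then X n else 0) * (if (h : ℤ) = c - b then v h else 0) := by
        refine Finset.sum_congr rfl fun h hh => ?_
        rw [Finset.mul_sum]
        refine Finset.sum_congr rfl fun n hn => ?_
        rw [mul_assoc, h1 h hh n hn, Finset.mul_sum, Finset.mul_sum]
        refine Finset.sum_congr rfl fun b _ => ?_
        rw [Finset.mul_sum, Finset.mul_sum]
        refine Finset.sum_congr rfl fun c _ => ?_
        split_ifs <;> ring
    _ = ∑ b ∈ s, ∑ c ∈ s, ∑ h ∈ Finset.Icc 1 K, ∑ n ∈ Finset.Icc 1 M, p b * q c *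
        (if (n : ℤ) = 2 * b - c then X n else 0) * (if (h : ℤ) = c - b then v h else 0) := by
        simp_rw [Finset.sum_comm (s := Finset.Icc 1 M) (t := s)]
        simp_rw [Finset.sum_comm (s := Finset.Icc 1 K) (t := s)]
    _ = _ := by
        refine Finset.sum_congr rfl fun b _ => Finset.sum_congr rfl fun c _ => ?_
        rw [Finset.mul_sum]
        refine Finset.sum_congr rfl fun h _ => ?_
        rw [Finset.mul_sum, Finset.sum_mul]

/-- The main estimate, without loss of `N ^ ε`. -/
lemma exists_norm_doubleShiftSum_le {l₁ l₂ l₃ : ℕ → ℂ} (h₁ : HasBoundedModel l₁)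
    (h₂ : HasBoundedModel l₂) (h₃ : HasBoundedModel l₃) {V W : ℝ → ℝ} (hV : IsBump V)
    (hW : IsBump W) :
    ∃ C : ℝ, 0 ≤ C ∧ ∀ N H : ℝ, 1 ≤ N → 0 < H →
      ‖doubleShiftSum l₁ l₂ l₃ V W N H‖ ≤ C * (Real.sqrt N * N / H + Real.sqrt N) := by
  obtain ⟨C₁, hC₁, hS⟩ := h₁.norm_twisted_sum_le hW
  obtain ⟨C₂, hC₂, hP⟩ := h₂.sum_norm_sq_le
  obtain ⟨C₃, hC₃, hQ⟩ := h₃.sum_norm_sq_le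
  obtain ⟨K, hK0, hK⟩ := hV.exists_lipschitz
  refine ⟨4 * (C₁ * (Real.sqrt C₂ * Real.sqrt C₃) * (6 * K ^ 2 + 1)), by positivity,
    fun N H hN hH => ?_⟩
  -- For H < 1/2 the sum over h is empty; otherwise the kernel bound applies at scale H.
  rcases lt_or_ge H (1 / 2) with hH2 | hH2
  · have h0 : ⌊2 * H⌋₊ = 0 := Nat.floor_eq_zero.mpr (by linarith)
    simp only [doubleShiftSum, h0, Finset.Icc_eq_empty_of_lt zero_lt_one, Finset.sum_empty,
      mul_zero, norm_zero]
    positivity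
  set M := ⌊2 * N⌋₊ + 2 * ⌊2 * H⌋₊ with hM
  have hker := integral_norm_kernel_le (G := fun u => (V u : ℂ)) (L := K)
    (fun u hu => by simp [hV.eq_zero hu])
    (fun u v => by rw [← Complex.ofReal_sub, Complex.norm_real]; exact hK u v) hH2
  have hmain := norm_weighted_trilinear_le (hS N hN) hker (Finset.Icc 1 M) l₂ l₃
  rw [hM, ← sum_progressions_eq, ← hM] at hmain
  have hMle : (M : ℝ) ≤ 4 * (N + H) := by
    have h1 := Nat.floor_le (by linarith : 0 ≤ 2 * N)
    have h2 := Nat.floor_le (by linarith : 0 ≤ 2 * H)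
    rw [hM]
    push_cast
    linarith
  have hPQ : Real.sqrt (∑ b ∈ Finset.Icc 1 M, ‖l₂ b‖ ^ 2) *
      Real.sqrt (∑ c ∈ Finset.Icc 1 M, ‖l₃ c‖ ^ 2) ≤
      Real.sqrt C₂ * Real.sqrt C₃ * (4 * (N + H)) := by
    calc _ ≤ Real.sqrt (C₂ * (4 * (N + H))) * Real.sqrt (C₃ * (4 * (N + H))) := by
          gcongr
          · exact (hP M).trans (by gcongr)
          · exact (hQ M).trans (by gcongr)
      _ = Real.sqrt C₂ * Real.sqrt C₃ *
          (Real.sqrt (4 * (N + H)) * Real.sqrt (4 * (N + H))) := by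
          rw [Real.sqrt_mul hC₂, Real.sqrt_mul hC₃]; ring
      _ = _ := by rw [Real.mul_self_sqrt (by linarith)]
  have hsum : doubleShiftSum l₁ l₂ l₃ V W N H = (1 / (H : ℂ)) *
      ∑ h ∈ Finset.Icc 1 ⌊2 * H⌋₊, (V ((h : ℝ) / H) : ℂ) * ∑ n ∈ Finset.Icc 1 ⌊2 * N⌋₊,
        l₁ n * (W ((n : ℝ) / N) : ℂ) * l₂ (n + h) * l₃ (n + 2 * h) := by
    rw [doubleShiftSum]
    congr 1
    refine Finset.sum_congr rfl fun h _ => ?_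
    congr 1
    refine Finset.sum_congr rfl fun n _ => ?_
    ring
  rw [hsum, norm_mul, norm_div, norm_one, Complex.norm_real, Real.norm_of_nonneg hH.le]
  calc _ ≤ 1 / H * (C₁ * Real.sqrt N * (Real.sqrt C₂ * Real.sqrt C₃ * (4 * (N + H))) *
        (6 * K ^ 2 + 1)) := by
        gcongr
        exact hmain.trans (by gcongr)
    _ = _ := by field_simp

/-! ### Comparison of exponents -/

lemma sqrt_mul_self_eq_rpow {N : ℝ} (hN : 0 < N) : Real.sqrt N * N = N ^ (3 / 2 : ℝ) := by
  rw [Real.sqrt_eq_rpow, ← Real.rpow_add_one hN.ne']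
  norm_num

end DoubleShift

end

theorem theorem1p1 :
    (∀ ε : ℝ, 0 < ε → ∃ δ : ℝ, 0 < δ ∧
      ∀ l₁ l₂ l₃ : ℕ → ℂ, DoubleShift.IsHeckeCoeff l₁ → DoubleShift.IsHeckeCoeff l₂ →
        DoubleShift.IsHeckeCoeff l₃ →
      ∀ V W : ℝ → ℝ, DoubleShift.IsBump V → DoubleShift.IsBump W →
      ∀ c : ℝ, 0 < c → ∃ C : ℝ, ∀ N H : ℝ, 1 ≤ N → c * N ^ (1 / 2 + ε) ≤ H →
        ‖DoubleShift.doubleShiftSum l₁ l₂ l₃ V W N H‖ ≤ C * N ^ (1 - δ)) ∧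
    (∀ l₁ l₂ l₃ : ℕ → ℂ, DoubleShift.IsHeckeCoeff l₁ → DoubleShift.IsHeckeCoeff l₂ →
        DoubleShift.IsHeckeCoeff l₃ →
      ∀ V W : ℝ → ℝ, DoubleShift.IsBump V → DoubleShift.IsBump W →
      ∀ ε : ℝ, 0 < ε → ∃ C : ℝ, ∀ N H : ℝ, 1 ≤ N → 0 < H →
        ‖DoubleShift.doubleShiftSum l₁ l₂ l₃ V W N H‖ ≤
          C * (N ^ (3 / 2 + ε) / H + N ^ (1 / 2 + ε))) := by
  constructor
  · intro ε hε
    -- The term N^(3/2)/H saves N^ε and the term √N saves N^(1/2).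
    refine ⟨min ε (1 / 2), by positivity, ?_⟩
    intro l₁ l₂ l₃ h₁ h₂ h₃ V W hV hW c hc
    obtain ⟨C, hC0, hC⟩ := DoubleShift.exists_norm_doubleShiftSum_le h₁.hasBoundedModel
      h₂.hasBoundedModel h₃.hasBoundedModel hV hW
    refine ⟨C * (1 / c + 1), fun N H hN hH => ?_⟩
    have hN0 : 0 < N := by linarith
    have hH0 : 0 < H := lt_of_lt_of_le (by positivity) hH
    refine (hC N H hN hH0).trans ?_
    rw [mul_assoc, DoubleShift.sqrt_mul_self_eq_rpow hN0, Real.sqrt_eq_rpow]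
    gcongr
    have h1 : N ^ (3 / 2 : ℝ) / H ≤ 1 / c * N ^ (1 - min ε (1 / 2)) := by
      calc N ^ (3 / 2 : ℝ) / H ≤ N ^ (3 / 2 : ℝ) / (c * N ^ (1 / 2 + ε)) := by gcongr
        _ = 1 / c * N ^ (1 - ε) := by
            rw [show (1 - ε) = 3 / 2 - (1 / 2 + ε) by ring, Real.rpow_sub hN0]
            field_simp
        _ ≤ _ := by
            gcongr
            exact min_le_left _ _
    have h2 : N ^ (1 / 2 : ℝ) ≤ N ^ (1 - min ε (1 / 2)) :=
      Real.rpow_le_rpow_of_exponent_le hN (by linarith [min_le_right ε (1 / 2 : ℝ)])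
    linarith
  · intro l₁ l₂ l₃ h₁ h₂ h₃ V W hV hW ε hε
    obtain ⟨C, hC0, hC⟩ := DoubleShift.exists_norm_doubleShiftSum_le h₁.hasBoundedModel
      h₂.hasBoundedModel h₃.hasBoundedModel hV hW
    -- The bound already holds with ε = 0; monotonicity of powers for N ≥ 1 suffices.
    refine ⟨C, fun N H hN hH => (hC N H hN hH).trans ?_⟩
    rw [DoubleShift.sqrt_mul_self_eq_rpow (by linarith), Real.sqrt_eq_rpow]
    gcongr <;> linarith
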